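/- A ribbon graph (map) with $e\ge 1$ edges is a pair of permutations $(\alpha,\sigma)$ of $H=\{1,\dots,2e\}$ such that $\alpha$ is a fixed point free involution and $\langle\alpha,\sigma\rangle$ acts transitively on $H$. For $N\ge 1$, an $N$-rooted map is a ribbon graph with an ordered choice of $N$ elements of $H$ lying in $N$ distinct cycles of $\sigma$ (fixed points count as cycles). An isomorphism is a permutation of $H$ that intertwines the two pairs $(\alpha,\sigma)$ and maps the $i$-th root to the $i$-th root for every $i$. Let $m_N(e)$ be the number of isomorphism classes of $N$-rooted maps with $e$ edges; for $e=0$ the only graph is a single point, which counts as one-rooted, so $m_1(0)=1$ and $m_N(0)=0$ for $N\ge 2$. Consider the formal series $$M_N(\lambda)=\sum_{e\ge 0} m_N(e)\lambda^{2e}\quad(N\ge1),\qquad \mathcal Z_j(\lambda)=\sum_{k\ge 0}\frac{(2k+j)!\,(2k-1)!!}{(2k)!}\lambda^{2k}\quad (j\ge 0,\ (-1)!!=1).$$ Define numbers $B_{n,2k-1}$ for $n\ge 0$, $k\ge 0$ by $B_{0,-1}=1$, $B_{0,2k-1}=0$ for $k\ge1$, and $$B_{n+1,2k-1}=B_{n,2k-3}+(2k+n+1)B_{n,2k-1}\qquad(n\ge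 0,\ k\ge 0),\qquad B_{n,-3}=0.$$ In particular $B_{1,-1}=B_{1,1}=1$ and $B_{n,2n+1}=0$. Let $H(i)=1$ for $i\ge 0$ and $H(i)=0$ for $i<0$, and for $j\ge 0$ let $P_j(X)$ be the polynomial in $X$ of degree at most one, with Laurent polynomials in $\lambda$ as coefficients, given by $$P_j(X)=\sum_{n=0}^{j}\binom jn\frac{j!}{n!}\sum_{k=0}^{n}(-1)^{n-k}B_{n,2k-1}\Bigl[\delta_{k,0}+H(k-1)\frac{X}{\lambda^{2k-2}}-H(k-2)\,(1-\lambda^2X)\sum_{m=0}^{k-2}\frac{(2m+1)!!}{\lambda^{2k-2m-2}}\Bigr].$$ For $N\ge1$ and $r_1,\dots,r_N$ in a commutative $\mathbb Q$-algebra put $$F_N(r_1,\dots,r_N)=\sum_{\alpha_1+2\alpha_2+\cdots+N\alpha_N=N}\frac{N!}{\alpha_1!\cdots\alpha_N!}\,(-1)^{\alpha_1+\cdots+\alpha_N-1}(\alpha_1+\cdots+\alpha_N-1)!\prod_{j=1}^N\Bigl(\frac{r_j}{(j!)^2}\Bigr)^{\alpha_j},$$ the sum being over integers $\alpha_1,\dots,\alpha_N\ge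 0$. **Theorem 3.** The following identities of formal Laurent series in $\lambda$ over $\mathbb Q$ hold. 1. $\mathcal Z_0-1=\lambda^2M_1\mathcal Z_0$ and $1/\mathcal Z_0=1-\lambda^2M_1$. 2. For every $j\ge 0$, $\mathcal Z_j/\mathcal Z_0=P_j(M_1)$. 3. For every $N\ge 1$, $M_N=F_N(\mathcal Z_1/\mathcal Z_0,\dots,\mathcal Z_N/\mathcal Z_0)$. Substituting the expressions of part 2 gives $M_N=Q_N(M_1)$, where $Q_N=F_N(P_1,\dots,P_N)$ is a polynomial in $X$ with Laurent polynomials in $\lambda$ as coefficients, of degree exactly $N$. -/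

import Mathlib

open LaurentSeries

noncomputable section

/-- A ribbon graph with `e` edges on the half-edges `Fin (2 * e)`: a fixed point free involution
`α`, whose orbits are the edges, and a permutation `σ`, whose cycles (fixed points included) are
the vertices, such that `⟨α, σ⟩` acts transitively on the half-edges. -/
structure RibbonGraph (e : ℕ) where
  α : Equiv.Perm (Fin (2 * e))
  σ : Equiv.Perm (Fin (2 * e))
  involutive : ∀ h, α (α h) = h
  fixedPointFree : ∀ h, α h ≠ h
  transitive :
    MulAction.IsPretransitive (Subgroup.closure ({α, σ} : Set (Equiv.Perm (Fin (2 * e)))))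
      (Fin (2 * e))

/-- An `N`-rooted ribbon graph with `e` edges: a ribbon graph with an ordered choice of `N` root
half-edges that lie on pairwise distinct vertices (cycles of `σ`). -/
structure NRootedGraph (N e : ℕ) extends RibbonGraph e where
  root : Fin N → Fin (2 * e)
  distinctVertices : ∀ i j, i ≠ j → ¬ σ.SameCycle (root i) (root j)

/-- `N`-rooted isomorphism: a relabelling of the half-edges that intertwines the two pairs of
permutations and maps the `k`-th root to the `k`-th root. -/
def NRootedGraph.Iso {N e : ℕ} (G G' : NRootedGraph N e) : Prop :=
  ∃ ψ : Equiv.Perm (Fin (2 * e)),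
    (∀ h, G'.α (ψ h) = ψ (G.α h)) ∧ (∀ h, G'.σ (ψ h) = ψ (G.σ h)) ∧
      ∀ k, ψ (G.root k) = G'.root k

/-- Isomorphism is an equivalence relation. -/
instance NRootedGraph.isoSetoid (N e : ℕ) : Setoid (NRootedGraph N e) where
  r := NRootedGraph.Iso
  iseqv :=
    { refl := fun _ => ⟨1, fun _ => rfl, fun _ => rfl, fun _ => rfl⟩
      symm := by
        rintro G G' ⟨ψ, hα, hσ, hr⟩
        refine ⟨ψ⁻¹, fun h => ?_, fun h => ?_, fun k => ?_⟩
        · apply ψ.injective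
          rw [← hα]; simp
        · apply ψ.injective
          rw [← hσ]; simp
        · rw [← hr]; simp
      trans := by
        rintro G G' G'' ⟨ψ, hα, hσ, hr⟩ ⟨ψ', hα', hσ', hr'⟩
        refine ⟨ψ' * ψ, fun h => ?_, fun h => ?_, fun k => ?_⟩
        · simp [hα, hα']
        · simp [hσ, hσ']
        · simp [hr, hr'] }

/-- `m_N(e)` for `N ≥ 1`: the number of `N`-rooted ribbon graphs with `e` edges, of any genus, up
to isomorphism. The only graph without half-edges is a single point, which counts as a one-rooted
graph. -/
def numRooted (N e : ℕ) : ℕ :=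
  if e = 0 then (if N = 1 then 1 else 0) else Nat.card (Quotient (NRootedGraph.isoSetoid N e))

/-- The formal generating function `M_N(λ) = ∑ₑ m_N(e) λ^{2e}`. -/
def genM (N : ℕ) : PowerSeries ℚ :=
  PowerSeries.mk fun i => if Even i then (numRooted N (i / 2) : ℚ) else 0

/-- The formal series `𝒵_j(λ) = ∑ₖ (2k+j)! (2k-1)!! / (2k)! λ^{2k}`, where `(-1)!! = 1`. -/
def serZ (j : ℕ) : PowerSeries ℚ :=
  PowerSeries.mk fun i =>
    if Even i then
      ((i + j).factorial : ℚ) * ((i - 1).doubleFactorial : ℚ) / (i.factorial : ℚ)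
    else 0

/-- `coeffB n k` is the coefficient `B_{n,2k-1}`. -/
def coeffB : ℕ → ℕ → ℕ
  | 0, 0 => 1
  | 0, _ + 1 => 0
  | n + 1, 0 => (n + 1) * coeffB n 0
  | n + 1, k + 1 => coeffB n k + (2 * (k + 1) + n + 1) * coeffB n (k + 1)

/-- The boundary values `B_{n,2k-1} = 0` for `k > n`; in particular `B_{n,2n+1} = 0`. -/
theorem coeffB_eq_zero : ∀ n k : ℕ, n < k → coeffB n k = 0
  | 0, _ + 1, _ => rfl
  | n + 1, k + 1, h => by
    rw [coeffB, coeffB_eq_zero n k (by omega), coeffB_eq_zero n (k + 1) (by omega), mul_zero, add_zero]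

/-- The remaining initial values `B_{0,-1} = B_{1,-1} = B_{1,1} = 1`. -/
theorem coeffB_initial : coeffB 0 0 = 1 ∧ coeffB 1 0 = 1 ∧ coeffB 1 1 = 1 := by
  simp [coeffB]

/-- The expression for `𝒵_j / 𝒵_0`, as a polynomial in one indeterminate `X` (standing for `M_1`)
whose coefficients are Laurent polynomials in `λ`; `LaurentPolynomial.T i` is `λ^i`. -/
def ratioPoly (j : ℕ) : Polynomial (LaurentPolynomial ℚ) :=
  ∑ n ∈ Finset.range (j + 1), ∑ k ∈ Finset.range (n + 1),
    Polynomial.C (LaurentPolynomial.C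
      ((j.choose n : ℚ) * ((j.factorial : ℚ) / (n.factorial : ℚ)) *
        ((-1) ^ (n - k) * (coeffB n k : ℚ)))) *
      ((if k = 0 then 1 else 0)
        + (if 1 ≤ k then
            Polynomial.C (LaurentPolynomial.T (-(2 * (k : ℤ) - 2))) * Polynomial.X
          else 0)
        - (if 2 ≤ k then
            (1 - Polynomial.C (LaurentPolynomial.T 2) * Polynomial.X) *
              ∑ m ∈ Finset.range (k - 1),
                Polynomial.C (LaurentPolynomial.C ((2 * m + 1).doubleFactorial : ℚ) *
                  LaurentPolynomial.T (-(2 * (k : ℤ) - 2 * (m : ℤ) - 2)))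
          else 0))

/-- The tuples `(α_1, …, α_N)` of natural numbers with `α_1 + 2 α_2 + ⋯ + N α_N = N`; the entry
`α_j` is `a (j - 1)`. The bound `α_j ≤ N` is automatic and only makes the set visibly finite. -/
def weightTuples (N : ℕ) : Finset (Fin N → ℕ) :=
  (Fintype.piFinset fun _ : Fin N => Finset.range (N + 1)).filter
    fun a => ∑ j : Fin N, ((j : ℕ) + 1) * a j = N

/-- The sum
`∑ N! / (α_1! ⋯ α_N!) (-1)^{α_1+⋯+α_N-1} (α_1+⋯+α_N-1)! ∏_j (r_j / (j!)²)^{α_j}`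
over all `α` with `α_1 + 2 α_2 + ⋯ + N α_N = N`, as a function of `r_1, …, r_N`
(with `r_j = 𝒵_j / 𝒵_0` for the generating functions). -/
def connectedSum {R : Type*} [CommRing R] [Algebra ℚ R] (N : ℕ) (r : ℕ → R) : R :=
  ∑ a ∈ weightTuples N,
    algebraMap ℚ R
      ((N.factorial : ℚ) / (∏ j : Fin N, ((a j).factorial : ℚ)) *
        ((-1) ^ ((∑ j : Fin N, a j) - 1) * (((∑ j : Fin N, a j) - 1).factorial : ℚ))) *
      ∏ j : Fin N,
        (algebraMap ℚ R (1 / (((j : ℕ) + 1).factorial : ℚ) ^ 2) * r ((j : ℕ) + 1)) ^ a j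

/-- The variable `λ` as a unit of the field of formal Laurent series. -/
def lamUnit : (ℚ⸨X⸩)ˣ :=
  Units.mk0 (HahnSeries.single (1 : ℤ) (1 : ℚ)) (by simp)

/-- A Laurent polynomial in `λ`, read as a formal Laurent series in `λ`. -/
def toSeries : LaurentPolynomial ℚ →+* ℚ⸨X⸩ :=
  LaurentPolynomial.eval₂ (HahnSeries.C : ℚ →+* ℚ⸨X⸩) lamUnit

/-- The value at `M_1(λ)` of a polynomial with Laurent polynomial coefficients in `λ`. -/
def evalAtM1 (P : Polynomial (LaurentPolynomial ℚ)) : ℚ⸨X⸩ :=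
  P.eval₂ toSeries (genM 1 : ℚ⸨X⸩)

end

section Configurations

open Equiv

theorem sameCycle_iff_forall_invariant {X : Type*} (σ : Perm X) (x y : X) :
    σ.SameCycle x y ↔ ∀ P : X → Prop, (∀ z, P (σ z) ↔ P z) → P x → P y := by
  constructor
  · rintro ⟨i, rfl⟩ P hP hx
    have key : ∀ i : ℤ, P ((σ ^ i) x) := by
      intro i
      induction i using Int.induction_on with
      | zero => simpa using hx
      | succ n ih =>
        rw [add_comm, zpow_add, zpow_one, Perm.mul_apply]
        exact (hP _).2 ih
      | pred n ih =>
        rw [← hP, ← Perm.mul_apply, ← zpow_one_add]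
        simpa using ih
    exact key i
  · intro h
    exact h (fun z => σ.SameCycle x z) (fun z => Perm.sameCycle_apply_right) (Perm.SameCycle.refl _ _)

/-- The points marked by `m` lie on pairwise distinct cycles of `τ`. -/
def SeparatesCycles {X : Type*} (m : X → Prop) (τ : Perm X) : Prop :=
  ∀ x y, m x → m y → τ.SameCycle x y → x = y

/-- `α` is an involution whose fixed points are exactly the points marked by `m`. -/
def IsMatchingOff {X : Type*} (m : X → Prop) (α : Perm X) : Prop :=
  (∀ x, α (α x) = x) ∧ ∀ x, α x = x ↔ m x

/-- No proper nonempty subset is invariant under both `α` and `τ`. -/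
def IsConn {X : Type*} (α τ : Perm X) : Prop :=
  ∀ P : X → Prop, (∀ x, P (α x) ↔ P x) → (∀ x, P (τ x) ↔ P x) → ∀ x y, P x → P y

theorem sameCycle_permCongr {X Y : Type*} (e : X ≃ Y) (τ : Perm X) (x y : X) :
    (e.permCongr τ).SameCycle (e x) (e y) ↔ τ.SameCycle x y := by
  rw [sameCycle_iff_forall_invariant, sameCycle_iff_forall_invariant]
  constructor
  · intro h P hP hx
    have := h (P ∘ e.symm) (fun z => by simpa [Equiv.permCongr_apply] using hP (e.symm z))
      (by simpa using hx)
    simpa using this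
  · intro h P hP hx
    exact h (P ∘ e) (fun z => by simpa [Equiv.permCongr_apply] using hP (e z)) hx

theorem separatesCycles_permCongr {X Y : Type*} (e : X ≃ Y) {m : X → Prop} {m' : Y → Prop}
    (h : ∀ x, m' (e x) ↔ m x) (τ : Perm X) :
    SeparatesCycles m' (e.permCongr τ) ↔ SeparatesCycles m τ := by
  constructor
  · intro H x y hx hy hxy
    exact e.injective (H _ _ ((h x).2 hx) ((h y).2 hy) ((sameCycle_permCongr e τ x y).2 hxy))
  · intro H x y hx hy hxy
    obtain ⟨x, rfl⟩ := e.surjective x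
    obtain ⟨y, rfl⟩ := e.surjective y
    rw [H x y ((h x).1 hx) ((h y).1 hy) ((sameCycle_permCongr e τ x y).1 hxy)]

theorem isMatchingOff_permCongr {X Y : Type*} (e : X ≃ Y) {m : X → Prop} {m' : Y → Prop}
    (h : ∀ x, m' (e x) ↔ m x) (α : Perm X) :
    IsMatchingOff m' (e.permCongr α) ↔ IsMatchingOff m α := by
  unfold IsMatchingOff
  simp only [← e.forall_congr_right (q := fun y => (e.permCongr α) ((e.permCongr α) y) = y),
    ← e.forall_congr_right (q := fun y => (e.permCongr α) y = y ↔ m' y)]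
  simp [Equiv.permCongr_apply, h]

theorem isConn_permCongr {X Y : Type*} (e : X ≃ Y) (α τ : Perm X) :
    IsConn (e.permCongr α) (e.permCongr τ) ↔ IsConn α τ := by
  constructor
  · intro H P hα hτ x y hx
    have := H (P ∘ e.symm) (fun z => by simpa [Equiv.permCongr_apply] using hα (e.symm z))
      (fun z => by simpa [Equiv.permCongr_apply] using hτ (e.symm z)) (e x) (e y) (by simpa using hx)
    simpa using this
  · intro H P hα hτ x y hx
    have := H (P ∘ e) (fun z => by simpa [Equiv.permCongr_apply] using hα (e z))
      (fun z => by simpa [Equiv.permCongr_apply] using hτ (e z)) (e.symm x) (e.symm y)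
      (by simpa using hx)
    simpa using this

theorem sameCycle_removeNone {A : Type*} (τ : Perm (Option A)) (x y : A) :
    Perm.SameCycle (removeNone τ) x y ↔ τ.SameCycle (some x) (some y) := by
  classical
  rw [sameCycle_iff_forall_invariant, sameCycle_iff_forall_invariant]
  constructor
  · intro h P hP hx
    refine h (fun z => P (some z)) (fun z => ?_) hx
    by_cases hz : ∃ w, τ (some z) = some w
    · rw [removeNone_some τ hz]; exact hP _
    · have hz' : τ (some z) = none := by
        cases h' : τ (some z) with
        | none => rfl
        | some w => exact absurd ⟨w, h'⟩ hz
      rw [removeNone_none τ hz', hP, ← hz', hP]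
  · intro h P hP hx
    refine h (fun z => z.elim (∀ w, τ none = some w → P w) P) (fun z => ?_) hx
    cases z with
    | none =>
      cases h' : τ none with
      | none => simp
      | some w => simp
    | some z =>
      cases h' : τ (some z) with
      | none =>
        have := removeNone_none τ h'
        simp only [Option.elim_none, Option.elim_some, ← this, Option.some.injEq]
        rw [← hP z]
        simp
      | some w =>
        have := removeNone_some τ ⟨w, h'⟩
        simp only [Option.elim_some]
        rw [h', Option.some.injEq] at this
        rw [← hP z, this]

theorem separatesCycles_option_iff {A : Type*} {m : Option A → Prop} (hm : ¬ m none)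
    (τ : Perm (Option A)) :
    SeparatesCycles m τ ↔ SeparatesCycles (fun a => m (some a)) (removeNone τ) := by
  constructor
  · intro H x y hx hy hxy
    exact Option.some.inj (H _ _ hx hy ((sameCycle_removeNone τ x y).1 hxy))
  · intro H x y hx hy hxy
    cases x with
    | none => exact absurd hx hm
    | some x =>
      cases y with
      | none => exact absurd hy hm
      | some y => rw [H x y hx hy ((sameCycle_removeNone τ x y).2 hxy)]

theorem card_separatesCycles_option {A : Type*} [Finite A] {m : Option A → Prop} (hm : ¬ m none) :
    Nat.card {τ : Perm (Option A) // SeparatesCycles m τ} =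
      (Nat.card A + 1) *
        Nat.card {τ : Perm A // SeparatesCycles (fun a => m (some a)) τ} := by
  classical
  have e : {τ : Perm (Option A) // SeparatesCycles m τ} ≃
      Option A × {τ : Perm A // SeparatesCycles (fun a => m (some a)) τ} :=
    (Perm.decomposeOption.subtypeEquiv (q := fun p => SeparatesCycles (fun a => m (some a)) p.2)
      (fun τ => by simpa using separatesCycles_option_iff hm τ)).trans
      { toFun := fun p => (p.1.1, ⟨p.1.2, p.2⟩)
        invFun := fun p => ⟨(p.1, p.2.1), p.2.2⟩
        left_inv := fun _ => rfl
        right_inv := fun _ => rfl }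
  rw [Nat.card_congr e, Nat.card_prod, Finite.card_option]

theorem card_separatesCycles_congr {X Y : Type*} (e : X ≃ Y) {m : X → Prop} {m' : Y → Prop}
    (h : ∀ x, m' (e x) ↔ m x) :
    Nat.card {τ : Perm X // SeparatesCycles m τ} = Nat.card {τ : Perm Y // SeparatesCycles m' τ} :=
  Nat.card_congr (e.permCongr.subtypeEquiv fun τ => (separatesCycles_permCongr e h τ).symm)

theorem card_separatesCycles_mul (n : ℕ) : ∀ {X : Type} [Finite X] (m : X → Prop),
    Nat.card {x // ¬ m x} = n →
    Nat.card {τ : Perm X // SeparatesCycles m τ} * (Nat.card {x // m x}).factorial =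
      (Nat.card X).factorial := by
  classical
  induction n with
  | zero =>
    intro X _ m h
    have hm : ∀ x, m x := by
      intro x
      by_contra hx
      have : IsEmpty {x // ¬ m x} := by
        rcases Nat.card_eq_zero.1 h with h | h
        · exact h
        · exact absurd (inferInstance : Finite {x // ¬ m x}) (not_finite_iff_infinite.2 h)
      exact this.false ⟨x, hx⟩
    have h1 : Nat.card {x // m x} = Nat.card X :=
      Nat.card_congr (Equiv.subtypeUnivEquiv hm)
    have h2 : Nat.card {τ : Perm X // SeparatesCycles m τ} = 1 := by
      rw [Nat.card_eq_one_iff_exists]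
      refine ⟨⟨1, fun x y _ _ hxy => by simpa using hxy⟩, fun τ => Subtype.ext (Equiv.ext fun x => ?_)⟩
      exact τ.2 _ _ (hm _) (hm _) (Perm.sameCycle_apply_left.2 (Perm.SameCycle.refl _ _))
    rw [h1, h2, one_mul]
  | succ n ih =>
    intro X _ m h
    obtain ⟨x₀, hx₀⟩ : ∃ x, ¬ m x := by
      by_contra! H
      have : IsEmpty {x // ¬ m x} := ⟨fun x => x.2 (H _)⟩
      simp at h
    let A := {x : X // x ≠ x₀}
    let e : Option A ≃ X := Equiv.optionSubtypeNe x₀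
    let m' : Option A → Prop := fun a => m (e a)
    have he0 : e none = x₀ := Equiv.optionSubtypeNe_none x₀
    have he1 : ∀ a : A, e (some a) = a.1 := Equiv.optionSubtypeNe_some x₀
    have hnone : ¬ m' none := by rwa [← he0] at hx₀
    have c1 : Nat.card X = Nat.card A + 1 := by
      rw [← Nat.card_congr e, Finite.card_option]
    have e2 : {x : Option A // ¬ m' x} ≃ {x // ¬ m x} := e.subtypeEquiv fun _ => Iff.rfl
    have e3 : Option {a : A // ¬ m' (some a)} ≃ {x : Option A // ¬ m' x} :=
      { toFun := fun o => o.elim ⟨none, hnone⟩ fun a => ⟨some a.1, a.2⟩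
        invFun := fun x => match x with
          | ⟨none, _⟩ => none
          | ⟨some a, h⟩ => some ⟨a, h⟩
        left_inv := fun o => by cases o <;> rfl
        right_inv := fun x => by rcases x with ⟨_ | a, h⟩ <;> rfl }
    have e4 : {a : A // m' (some a)} ≃ {x // m x} :=
      { toFun := fun a => ⟨a.1.1, by rw [← he1]; exact a.2⟩
        invFun := fun x => ⟨⟨x.1, fun h => hx₀ (h ▸ x.2)⟩, (congrArg m (he1 _)).mpr x.2⟩
        left_inv := fun _ => rfl
        right_inv := fun _ => rfl }
    have c2 : Nat.card {a : A // ¬ m' (some a)} = n := by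
      have := Nat.card_congr (e3.trans e2)
      rw [Finite.card_option, h] at this
      omega
    have := ih (fun a : A => m' (some a)) c2
    rw [Nat.card_congr e4] at this
    rw [← card_separatesCycles_congr e (m := m') (fun _ => Iff.rfl),
      card_separatesCycles_option hnone, c1, Nat.factorial_succ, mul_assoc, this]

theorem card_fixedPointFree_involution (n : ℕ) (X : Type) [Finite X] (hX : Nat.card X = n) :
    Nat.card {α : Perm X // (∀ x, α (α x) = x) ∧ ∀ x, α x ≠ x} =
      if Even n then (n - 1).doubleFactorial else 0 := by
  classical
  have := Fintype.ofFinite X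
  rw [Nat.card_eq_fintype_card] at hX
  have hsupp : ∀ α : Perm X, (∀ x, α x ≠ x) ↔ α.support.card = n := by
    intro α
    rw [← hX, Finset.card_eq_iff_eq_univ, Finset.eq_univ_iff_forall]
    simp [Perm.mem_support]
  have htype : ∀ α : Perm X, ((∀ x, α (α x) = x) ∧ ∀ x, α x ≠ x) ↔
      ∃ e, n = 2 * e ∧ α.cycleType = Multiset.replicate e 2 := by
    intro α
    rw [hsupp, ← Perm.sum_cycleType]
    constructor
    · rintro ⟨h1, h2⟩
      have h3 : ∀ k ∈ α.cycleType, k = 2 := by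
        intro k hk
        have hd : k ∣ orderOf α := Perm.dvd_of_mem_cycleType hk
        have ho : orderOf α ∣ 2 := orderOf_dvd_of_pow_eq_one (by ext x; simp [sq, h1])
        have := Perm.two_le_of_mem_cycleType hk
        exact le_antisymm (Nat.le_of_dvd (by norm_num) (hd.trans ho)) this
      have h4 := Multiset.eq_replicate_card.2 h3
      refine ⟨α.cycleType.card, ?_, h4⟩
      rw [h4] at h2
      simp at h2
      omega
    · rintro ⟨e, he, hα⟩
      refine ⟨?_, by rw [hα]; simp [he, mul_comm]⟩
      have : orderOf α ∣ 2 := by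
        rw [← Perm.lcm_cycleType, hα]
        exact Multiset.lcm_dvd.2 fun b hb => by rw [Multiset.eq_of_mem_replicate hb]
      have h := orderOf_dvd_iff_pow_eq_one.1 this
      intro x
      simpa [sq] using congrArg (fun f => f x) h
  split_ifs with hn
  · obtain ⟨e, he⟩ := hn
    have he : n = 2 * e := by omega
    have h1 : Nat.card {α : Perm X // (∀ x, α (α x) = x) ∧ ∀ x, α x ≠ x} =
        ({α : Perm X | α.cycleType = Multiset.replicate e 2} : Finset (Perm X)).card := by
      rw [← Fintype.card_subtype, ← Nat.card_eq_fintype_card]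
      refine Nat.card_congr (Equiv.subtypeEquivRight fun α => ?_)
      rw [htype]
      constructor
      · rintro ⟨e', h, h'⟩
        obtain rfl : e = e' := by omega
        exact h'
      · exact fun h => ⟨e, he, h⟩
    rw [h1, Perm.card_of_cycleType, if_pos]
    · have h2 : (∏ i ∈ (Multiset.replicate e 2).toFinset,
          ((Multiset.replicate e 2).count i).factorial) = e.factorial := by
        rcases Nat.eq_zero_or_pos e with rfl | hpos
        · simp
        · rw [Multiset.toFinset_replicate, if_neg hpos.ne']
          simp
      rw [h2, hX, he]
      simp only [Multiset.sum_replicate, smul_eq_mul, Multiset.prod_replicate]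
      rw [mul_comm e 2, Nat.sub_self, Nat.factorial_zero, one_mul]
      apply Nat.div_eq_of_eq_mul_right (by positivity)
      rcases Nat.eq_zero_or_pos e with rfl | hpos
      · simp
      · obtain ⟨k, rfl⟩ : ∃ k, e = k + 1 := ⟨e - 1, by omega⟩
        rw [← Nat.doubleFactorial_two_mul, show 2 * (k + 1) = (2 * k + 1) + 1 by ring,
          Nat.factorial_eq_mul_doubleFactorial]
        rfl
    · refine ⟨by simp [hX, he, mul_comm], fun a ha => by rw [Multiset.eq_of_mem_replicate ha]⟩
  · have : IsEmpty {α : Perm X // (∀ x, α (α x) = x) ∧ ∀ x, α x ≠ x} := by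
      refine ⟨fun α => ?_⟩
      obtain ⟨e, he, -⟩ := (htype α.1).1 α.2
      exact hn (by rw [he]; simp)
    simp

theorem card_isMatchingOff {X : Type} [Finite X] (m : X → Prop) (n : ℕ)
    (hn : Nat.card {x // ¬ m x} = n) :
    Nat.card {α : Perm X // IsMatchingOff m α} =
      if Even n then (n - 1).doubleFactorial else 0 := by
  classical
  rw [← card_fixedPointFree_involution n _ hn]
  refine Nat.card_congr ?_
  symm
  refine ((Perm.subtypeEquivSubtypePerm fun x => ¬ m x).subtypeEquiv
    (q := fun α => IsMatchingOff m α.1) fun α => ?_).trans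
    (Equiv.subtypeSubtypeEquivSubtype (q := IsMatchingOff m) fun {α} h a ha =>
      (h.2 a).2 (not_not.1 ha))
  have hin : ∀ x (hx : ¬ m x), Perm.ofSubtype α x = α ⟨x, hx⟩ := fun x hx =>
    Perm.ofSubtype_apply_of_mem α hx
  have hout : ∀ x (hx : m x), Perm.ofSubtype α x = x := fun x hx =>
    Perm.ofSubtype_apply_of_not_mem α (not_not.2 hx)
  simp only [IsMatchingOff, Perm.subtypeEquivSubtypePerm_apply_coe]
  constructor
  · rintro ⟨h1, h2⟩
    refine ⟨fun x => ?_, fun x => ?_⟩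
    · by_cases hx : m x
      · rw [hout x hx, hout x hx]
      · rw [hin x hx, hin _ (α ⟨x, hx⟩).2, h1]
    · by_cases hx : m x
      · simp [hout x hx, hx]
      · rw [hin x hx]
        simpa [hx, Subtype.ext_iff] using h2 ⟨x, hx⟩
  · rintro ⟨h1, h2⟩
    refine ⟨fun x => Subtype.ext ?_, fun x hx => ?_⟩
    · have := h1 x.1
      rwa [hin x.1 x.2, hin _ (α x).2] at this
    · exact x.2 ((h2 x.1).1 (by rw [hin x.1 x.2]; exact congrArg Subtype.val hx))

/-- `α` matches the unmarked points and the cycles of `τ` contain at most one marked point each. -/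
def IsMarkedPair {X : Type*} (m : X → Prop) (p : Perm X × Perm X) : Prop :=
  IsMatchingOff m p.1 ∧ SeparatesCycles m p.2

theorem card_isMarkedPair {X : Type} [Finite X] (m : X → Prop) (n N : ℕ)
    (hn : Nat.card {x // ¬ m x} = n) (hN : Nat.card {x // m x} = N) :
    Nat.card {p : Perm X × Perm X // IsMarkedPair m p} * N.factorial =
      (if Even n then (n - 1).doubleFactorial else 0) * (n + N).factorial := by
  classical
  have h1 : Nat.card X = n + N := by
    rw [← hn, ← hN, add_comm, ← Nat.card_sum]
    exact Nat.card_congr (Equiv.sumCompl m).symm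
  have h2 := Nat.card_congr
    (Equiv.subtypeProdEquivProd (p := IsMatchingOff m) (q := SeparatesCycles m))
  rw [Nat.card_prod] at h2
  rw [show Nat.card {p : Perm X × Perm X // IsMarkedPair m p} = _ from h2,
    card_isMatchingOff m n hn, mul_assoc, ← h1, ← card_separatesCycles_mul n m hn,
    hN]

/-- The points that cannot be separated from `x₀` by a set invariant under `α` and `τ`. -/
def InComponent {X : Type*} (p : Perm X × Perm X) (x₀ y : X) : Prop :=
  ∀ P : X → Prop, (∀ x, P (p.1 x) ↔ P x) → (∀ x, P (p.2 x) ↔ P x) → P x₀ → P y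

theorem inComponent_fst_apply {X : Type*} (p : Perm X × Perm X) (x₀ x : X) :
    InComponent p x₀ (p.1 x) ↔ InComponent p x₀ x :=
  ⟨fun h P h1 h2 h0 => (h1 _).1 (h P h1 h2 h0), fun h P h1 h2 h0 => (h1 _).2 (h P h1 h2 h0)⟩

theorem inComponent_snd_apply {X : Type*} (p : Perm X × Perm X) (x₀ x : X) :
    InComponent p x₀ (p.2 x) ↔ InComponent p x₀ x :=
  ⟨fun h P h1 h2 h0 => (h2 _).1 (h P h1 h2 h0), fun h P h1 h2 h0 => (h2 _).2 (h P h1 h2 h0)⟩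

/-- The restriction of a pair of permutations to a common invariant set. -/
def restrictPair {X : Type*} (Y : X → Prop) (p : Perm X × Perm X)
    (h1 : ∀ x, Y (p.1 x) ↔ Y x) (h2 : ∀ x, Y (p.2 x) ↔ Y x) :
    Perm {x // Y x} × Perm {x // Y x} :=
  (p.1.subtypePerm h1, p.2.subtypePerm h2)

theorem isMarkedPair_iff_restrict {X : Type*} (m Y : X → Prop) (p : Perm X × Perm X)
    (h1 : ∀ x, Y (p.1 x) ↔ Y x) (h2 : ∀ x, Y (p.2 x) ↔ Y x) :
    IsMarkedPair m p ↔
      IsMarkedPair (fun x : {x // Y x} => m x.1) (restrictPair Y p h1 h2) ∧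
        IsMarkedPair (fun x : {x // ¬ Y x} => m x.1)
          (restrictPair (fun x => ¬ Y x) p (fun x => not_congr (h1 x)) fun x => not_congr (h2 x)) := by
  constructor
  · rintro ⟨⟨a, b⟩, c⟩
    refine ⟨⟨⟨fun x => Subtype.ext (a x.1), fun x => ?_⟩, fun x y hx hy hxy => Subtype.ext ?_⟩,
      ⟨⟨fun x => Subtype.ext (a x.1), fun x => ?_⟩, fun x y hx hy hxy => Subtype.ext ?_⟩⟩
    · exact Subtype.ext_iff.trans (b x.1)
    · exact c _ _ hx hy ((Perm.sameCycle_subtypePerm (h := h2)).1 hxy)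
    · exact Subtype.ext_iff.trans (b x.1)
    · exact c _ _ hx hy ((Perm.sameCycle_subtypePerm (f := p.2)
        (h := fun x => not_congr (h2 x))).1 hxy)
  · rintro ⟨⟨⟨a, b⟩, c⟩, ⟨⟨a', b'⟩, c'⟩⟩
    refine ⟨⟨fun x => ?_, fun x => ?_⟩, fun x y hx hy hxy => ?_⟩
    · by_cases hx : Y x
      · exact congrArg Subtype.val (a ⟨x, hx⟩)
      · exact congrArg Subtype.val (a' ⟨x, hx⟩)
    · by_cases hx : Y x
      · exact Subtype.ext_iff.symm.trans (b ⟨x, hx⟩)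
      · exact Subtype.ext_iff.symm.trans (b' ⟨x, hx⟩)
    · by_cases hY : Y x
      · have hY' : Y y := (sameCycle_iff_forall_invariant _ _ _).1 hxy Y h2 hY
        exact congrArg Subtype.val
          (c ⟨x, hY⟩ ⟨y, hY'⟩ hx hy ((Perm.sameCycle_subtypePerm (h := h2)).2 hxy))
      · have hY' : ¬ Y y := (sameCycle_iff_forall_invariant _ _ _).1 hxy (fun x => ¬ Y x)
          (fun x => not_congr (h2 x)) hY
        exact congrArg Subtype.val
          (c' ⟨x, hY⟩ ⟨y, hY'⟩ hx hy ((Perm.sameCycle_subtypePerm (f := p.2)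
            (h := fun x => not_congr (h2 x))).2 hxy))

theorem inComponent_iff_isConn_restrict {X : Type*} (Y : X → Prop) (p : Perm X × Perm X)
    (h1 : ∀ x, Y (p.1 x) ↔ Y x) (h2 : ∀ x, Y (p.2 x) ↔ Y x) (x₀ : X) (hx₀ : Y x₀) :
    (∀ y, InComponent p x₀ y ↔ Y y) ↔
      IsConn (restrictPair Y p h1 h2).1 (restrictPair Y p h1 h2).2 := by
  constructor
  · intro h
    have key : ∀ P : {x // Y x} → Prop, (∀ x, P ((restrictPair Y p h1 h2).1 x) ↔ P x) →
        (∀ x, P ((restrictPair Y p h1 h2).2 x) ↔ P x) → P ⟨x₀, hx₀⟩ → ∀ y, P y := by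
      intro P i1 i2 h0 y
      obtain ⟨_, hy⟩ := (h y.1).2 y.2 (fun z => ∃ hz : Y z, P ⟨z, hz⟩)
        (fun z => ⟨fun ⟨hz, hP⟩ => ⟨(h1 z).1 hz, (i1 ⟨z, (h1 z).1 hz⟩).1 hP⟩,
          fun ⟨hz, hP⟩ => ⟨(h1 z).2 hz, (i1 ⟨z, hz⟩).2 hP⟩⟩)
        (fun z => ⟨fun ⟨hz, hP⟩ => ⟨(h2 z).1 hz, (i2 ⟨z, (h2 z).1 hz⟩).1 hP⟩,
          fun ⟨hz, hP⟩ => ⟨(h2 z).2 hz, (i2 ⟨z, hz⟩).2 hP⟩⟩)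
        ⟨hx₀, h0⟩
      exact hy
    intro P i1 i2 x y hx
    by_cases h0 : P ⟨x₀, hx₀⟩
    · exact key P i1 i2 h0 y
    · exact absurd hx (key (fun z => ¬ P z) (fun z => not_congr (i1 z))
        (fun z => not_congr (i2 z)) h0 x)
  · intro h y
    constructor
    · exact fun hy => hy Y h1 h2 hx₀
    · intro hy P i1 i2 h0
      exact h (fun z => P z.1) (fun z => i1 z.1) (fun z => i2 z.1) ⟨x₀, hx₀⟩ ⟨y, hy⟩ h0

/-- Pairs for which the component of `x₀` is `Y` split into a connected pair on `Y` and a pair on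
the complement of `Y`. -/
def componentEquiv {X : Type*} (m Y : X → Prop) [DecidablePred Y] (x₀ : X) (hx₀ : Y x₀) :
    {p : Perm X × Perm X // IsMarkedPair m p ∧ ∀ y, InComponent p x₀ y ↔ Y y} ≃
      {p : Perm {x // Y x} × Perm {x // Y x} //
        IsMarkedPair (fun x => m x.1) p ∧ IsConn p.1 p.2} ×
      {p : Perm {x // ¬ Y x} × Perm {x // ¬ Y x} // IsMarkedPair (fun x => m x.1) p} :=
  have inv1 : ∀ p : {p : Perm X × Perm X // IsMarkedPair m p ∧ ∀ y, InComponent p x₀ y ↔ Y y},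
      ∀ x, Y (p.1.1 x) ↔ Y x := fun p x => by
    rw [← p.2.2, ← p.2.2, inComponent_fst_apply]
  have inv2 : ∀ p : {p : Perm X × Perm X // IsMarkedPair m p ∧ ∀ y, InComponent p x₀ y ↔ Y y},
      ∀ x, Y (p.1.2 x) ↔ Y x := fun p x => by
    rw [← p.2.2, ← p.2.2, inComponent_snd_apply]
  have invC : ∀ (q : Perm {x // Y x}) (r : Perm {x // ¬ Y x}) (x : X),
      Y (q.subtypeCongr r x) ↔ Y x := fun q r x => by
    by_cases hx : Y x
    · rw [Perm.subtypeCongr.left_apply _ _ hx]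
      exact iff_of_true (q ⟨x, hx⟩).2 hx
    · rw [Perm.subtypeCongr.right_apply _ _ hx]
      exact iff_of_false (r ⟨x, hx⟩).2 hx
  have resL : ∀ (q : Perm {x // Y x}) (r : Perm {x // ¬ Y x}),
      (q.subtypeCongr r).subtypePerm (invC q r) = q := fun q r => by
    ext x
    simp [Perm.subtypeCongr.left_apply _ _ x.2]
  have resR : ∀ (q : Perm {x // Y x}) (r : Perm {x // ¬ Y x}),
      (q.subtypeCongr r).subtypePerm (fun x => not_congr (invC q r x)) = r := fun q r => by
    ext x
    simp [Perm.subtypeCongr.right_apply _ _ x.2]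
  have glue : ∀ (f : Perm X) (h : ∀ x, Y (f x) ↔ Y x),
      (f.subtypePerm h).subtypeCongr (f.subtypePerm fun x => not_congr (h x)) = f := fun f h => by
    ext x
    by_cases hx : Y x
    · rw [Perm.subtypeCongr.left_apply _ _ hx]; rfl
    · rw [Perm.subtypeCongr.right_apply _ _ hx]; rfl
  { toFun := fun p =>
      (⟨restrictPair Y p.1 (inv1 p) (inv2 p),
          ((isMarkedPair_iff_restrict m Y p.1 (inv1 p) (inv2 p)).1 p.2.1).1,
          (inComponent_iff_isConn_restrict Y p.1 (inv1 p) (inv2 p) x₀ hx₀).1 p.2.2⟩,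
        ⟨restrictPair (fun x => ¬ Y x) p.1 (fun x => not_congr (inv1 p x))
            fun x => not_congr (inv2 p x),
          ((isMarkedPair_iff_restrict m Y p.1 (inv1 p) (inv2 p)).1 p.2.1).2⟩)
    invFun := fun q =>
      ⟨(q.1.1.1.subtypeCongr q.2.1.1, q.1.1.2.subtypeCongr q.2.1.2), by
        have e1 := resL q.1.1.1 q.2.1.1
        have e2 := resL q.1.1.2 q.2.1.2
        have e3 := resR q.1.1.1 q.2.1.1
        have e4 := resR q.1.1.2 q.2.1.2
        rw [isMarkedPair_iff_restrict m Y _ (invC _ _) (invC _ _),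
          inComponent_iff_isConn_restrict Y _ (invC _ _) (invC _ _) x₀ hx₀]
        simp only [restrictPair, e1, e2, e3, e4]
        exact ⟨⟨q.1.2.1, q.2.2⟩, q.1.2.2⟩⟩
    left_inv := fun p => Subtype.ext (Prod.ext (glue p.1.1 (inv1 p)) (glue p.1.2 (inv2 p)))
    right_inv := fun q => Prod.ext
      (Subtype.ext (Prod.ext (resL q.1.1.1 q.2.1.1) (resL q.1.1.2 q.2.1.2)))
      (Subtype.ext (Prod.ext (resR q.1.1.1 q.2.1.1) (resR q.1.1.2 q.2.1.2))) }

/-- The number of marked pairs on `n` unmarked and `N` marked points. -/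
noncomputable def markedCount (n N : ℕ) : ℕ :=
  Nat.card {p : Perm (Fin n ⊕ Fin N) × Perm (Fin n ⊕ Fin N) //
    IsMarkedPair (fun x => x.isRight = true) p}

/-- The number of connected marked pairs on `n` unmarked and `N` marked points. -/
noncomputable def connCount (n N : ℕ) : ℕ :=
  Nat.card {p : Perm (Fin n ⊕ Fin N) × Perm (Fin n ⊕ Fin N) //
    IsMarkedPair (fun x => x.isRight = true) p ∧ IsConn p.1 p.2}

theorem exists_equiv_sum {X : Type*} [Finite X] (m : X → Prop) :
    ∃ e : X ≃ Fin (Nat.card {x // ¬ m x}) ⊕ Fin (Nat.card {x // m x}),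
      ∀ x, (e x).isRight = true ↔ m x := by
  classical
  let e : X ≃ Fin (Nat.card {x // ¬ m x}) ⊕ Fin (Nat.card {x // m x}) :=
    (Equiv.sumCompl m).symm.trans ((Equiv.sumComm _ _).trans
      ((Finite.equivFin _).sumCongr (Finite.equivFin _)))
  refine ⟨e, fun x => ?_⟩
  by_cases hx : m x
  · simp [e, hx, Equiv.sumCompl_symm_apply_of_pos]
  · simp [e, hx, Equiv.sumCompl_symm_apply_of_neg]

theorem card_isMarkedPair_eq_markedCount {X : Type*} [Finite X] (m : X → Prop) :
    Nat.card {p : Perm X × Perm X // IsMarkedPair m p} =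
      markedCount (Nat.card {x // ¬ m x}) (Nat.card {x // m x}) := by
  obtain ⟨e, he⟩ := exists_equiv_sum m
  refine Nat.card_congr ((e.permCongr.prodCongr e.permCongr).subtypeEquiv fun p => ?_)
  exact (and_congr (isMatchingOff_permCongr e he p.1) (separatesCycles_permCongr e he p.2)).symm

theorem card_isConn_eq_connCount {X : Type*} [Finite X] (m : X → Prop) :
    Nat.card {p : Perm X × Perm X // IsMarkedPair m p ∧ IsConn p.1 p.2} =
      connCount (Nat.card {x // ¬ m x}) (Nat.card {x // m x}) := by
  obtain ⟨e, he⟩ := exists_equiv_sum m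
  refine Nat.card_congr ((e.permCongr.prodCongr e.permCongr).subtypeEquiv fun p => ?_)
  exact (and_congr (and_congr (isMatchingOff_permCongr e he p.1)
    (separatesCycles_permCongr e he p.2)) (isConn_permCongr e p.1 p.2)).symm

theorem card_isRight_subtype {α β : Type*} (Q : α ⊕ β → Prop) :
    Nat.card {x : {x // Q x} // x.1.isRight = true} = Nat.card {b // Q (Sum.inr b)} :=
  Nat.card_congr
    { toFun := fun x => match x with
        | ⟨⟨Sum.inr b, h⟩, _⟩ => ⟨b, h⟩
      invFun := fun b => ⟨⟨Sum.inr b.1, b.2⟩, rfl⟩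
      left_inv := fun x => by
        rcases x with ⟨⟨a | b, h⟩, h'⟩
        · simp at h'
        · rfl
      right_inv := fun _ => rfl }

theorem card_not_isRight_subtype {α β : Type*} (Q : α ⊕ β → Prop) :
    Nat.card {x : {x // Q x} // ¬ x.1.isRight = true} = Nat.card {a // Q (Sum.inl a)} :=
  Nat.card_congr
    { toFun := fun x => match x with
        | ⟨⟨Sum.inl a, h⟩, _⟩ => ⟨a, h⟩
        | ⟨⟨Sum.inr _, _⟩, h'⟩ => (h' rfl).elim
      invFun := fun a => ⟨⟨Sum.inl a.1, a.2⟩, by simp⟩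
      left_inv := fun x => by
        rcases x with ⟨⟨a | b, h⟩, h'⟩
        · rfl
        · exact (h' rfl).elim
      right_inv := fun _ => rfl }

theorem card_isRight {α β : Type*} : Nat.card {x : α ⊕ β // x.isRight = true} = Nat.card β := by
  have h := card_isRight_subtype (fun _ : α ⊕ β => True)
  rw [Nat.card_congr (Equiv.subtypeUnivEquiv fun _ => trivial)] at h
  rw [← h]
  exact Nat.card_congr ((Equiv.subtypeUnivEquiv fun _ => trivial).subtypeEquiv fun _ => Iff.rfl).symm

theorem card_not_isRight {α β : Type*} :
    Nat.card {x : α ⊕ β // ¬ x.isRight = true} = Nat.card α := by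
  have h := card_not_isRight_subtype (fun _ : α ⊕ β => True)
  rw [Nat.card_congr (Equiv.subtypeUnivEquiv fun _ => trivial)] at h
  rw [← h]
  exact Nat.card_congr ((Equiv.subtypeUnivEquiv fun _ => trivial).subtypeEquiv fun _ => Iff.rfl).symm

theorem markedCount_mul_factorial (n N : ℕ) :
    markedCount n N * N.factorial =
      (if Even n then (n - 1).doubleFactorial else 0) * (n + N).factorial := by
  exact card_isMarkedPair _ n N (card_not_isRight.trans (by simp)) (card_isRight.trans (by simp))

/-- The set of points of `Fin n ⊕ Option (Fin N)` given by its unmarked and its marked points, the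
point `none` included. -/
def pointedSet {n N : ℕ} (A : Finset (Fin n)) (J : Finset (Fin N)) (x : Fin n ⊕ Option (Fin N)) :
    Prop :=
  Sum.elim (fun a => a ∈ A) (fun o => o.elim True fun j => j ∈ J) x

theorem card_pointedSet {n N : ℕ} (A : Finset (Fin n)) (J : Finset (Fin N)) :
    Nat.card {x : {x // pointedSet A J x} // ¬ x.1.isRight = true} = A.card ∧
    Nat.card {x : {x // pointedSet A J x} // x.1.isRight = true} = J.card + 1 ∧
    Nat.card {x : {x // ¬ pointedSet A J x} // ¬ x.1.isRight = true} = n - A.card ∧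
    Nat.card {x : {x // ¬ pointedSet A J x} // x.1.isRight = true} = N - J.card := by
  classical
  rw [card_isRight_subtype, card_isRight_subtype, card_not_isRight_subtype,
    card_not_isRight_subtype]
  refine ⟨?_, ?_, ?_, ?_⟩
  · simp [pointedSet]
  · have e : Option {j // j ∈ J} ≃ {o : Option (Fin N) // pointedSet (n := n) A J (Sum.inr o)} :=
      { toFun := fun o => o.elim ⟨none, trivial⟩ fun j => ⟨some j.1, j.2⟩
        invFun := fun x => match x with
          | ⟨none, _⟩ => none
          | ⟨some j, h⟩ => some ⟨j, h⟩
        left_inv := fun o => by cases o <;> rfl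
        right_inv := fun x => by rcases x with ⟨_ | a, h⟩ <;> rfl }
    rw [← Nat.card_congr e, Finite.card_option]
    simp
  · simp [pointedSet, Fintype.card_subtype_compl]
  · have e : {j // j ∉ J} ≃ {o : Option (Fin N) // ¬ pointedSet (n := n) A J (Sum.inr o)} :=
      { toFun := fun j => ⟨some j.1, j.2⟩
        invFun := fun x => match x with
          | ⟨none, h⟩ => (h trivial).elim
          | ⟨some j, h⟩ => ⟨j, h⟩
        left_inv := fun _ => rfl
        right_inv := fun x => by
          rcases x with ⟨_ | a, h⟩
          · exact (h trivial).elim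
          · rfl }
    rw [← Nat.card_congr e]
    simp [Fintype.card_subtype_compl]

theorem markedCount_succ (n N : ℕ) :
    markedCount n (N + 1) = ∑ i ∈ Finset.range (N + 1), N.choose i *
      ∑ a ∈ Finset.range (n + 1), n.choose a * (connCount a (i + 1) * markedCount (n - a) (N - i)) := by
  classical
  let m : Fin n ⊕ Option (Fin N) → Prop := fun x => x.isRight = true
  let f : {p // IsMarkedPair m p} → Finset (Fin n) × Finset (Fin N) := fun p =>
    (Finset.univ.filter fun a => InComponent p.1 (Sum.inr none) (Sum.inl a),
      Finset.univ.filter fun j => InComponent p.1 (Sum.inr none) (Sum.inr (some j)))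
  have hf : ∀ p A J, f p = (A, J) ↔
      ∀ y, InComponent p.1 (Sum.inr none) y ↔ pointedSet A J y := by
    intro p A J
    rw [Sum.forall, Option.forall, Prod.ext_iff, Finset.ext_iff, Finset.ext_iff]
    have : InComponent p.1 (Sum.inr none) (Sum.inr none) := fun P _ _ h => h
    simp [f, pointedSet, this]
  have h0 : markedCount n (N + 1) = Nat.card {p // IsMarkedPair m p} := by
    rw [card_isMarkedPair_eq_markedCount, card_not_isRight, card_isRight]
    simp
  have hfib : ∀ AJ : Finset (Fin n) × Finset (Fin N), Nat.card {p // f p = AJ} =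
      connCount AJ.1.card (AJ.2.card + 1) * markedCount (n - AJ.1.card) (N - AJ.2.card) := by
    rintro ⟨A, J⟩
    have e1 : {p // f p = (A, J)} ≃ {p : Perm _ × Perm _ // IsMarkedPair m p ∧
        ∀ y, InComponent p (Sum.inr none) y ↔ pointedSet A J y} :=
      (Equiv.subtypeEquivRight fun p => hf p A J).trans
        (Equiv.subtypeSubtypeEquivSubtypeInter (IsMarkedPair m) fun p =>
          ∀ y, InComponent p (Sum.inr none) y ↔ pointedSet A J y)
    rw [Nat.card_congr (e1.trans (componentEquiv m (pointedSet A J) (Sum.inr none) trivial)),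
      Nat.card_prod, card_isConn_eq_connCount, card_isMarkedPair_eq_markedCount]
    obtain ⟨c1, c2, c3, c4⟩ := card_pointedSet A J
    simp only [m, c1, c2, c3, c4]
  rw [h0, ← Nat.card_congr (Equiv.sigmaFiberEquiv f), Nat.card_sigma]
  simp_rw [hfib]
  rw [Fintype.sum_prod_type_right]
  simp_rw [← Finset.powerset_univ]
  have inner : ∀ J : Finset (Fin N), (∑ A ∈ (Finset.univ : Finset (Fin n)).powerset,
      connCount A.card (J.card + 1) * markedCount (n - A.card) (N - J.card)) =
      ∑ a ∈ Finset.range (n + 1),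
        n.choose a * (connCount a (J.card + 1) * markedCount (n - a) (N - J.card)) := by
    intro J
    rw [Finset.sum_powerset_apply_card
      (fun a => connCount a (J.card + 1) * markedCount (n - a) (N - J.card))]
    simp
  simp_rw [inner]
  rw [Finset.sum_powerset_apply_card (fun i => ∑ a ∈ Finset.range (n + 1),
        n.choose a * (connCount a (i + 1) * markedCount (n - a) (N - i)))]
  simp

/-- The permutation of `H ⊕ I` that exchanges every `i : I` with its root `r i`. -/
noncomputable def rootSwap {H I : Type*} (r : I → H) (hr : Function.Injective r) :
    Perm (H ⊕ I) :=
  open Classical in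
  Function.Involutive.toPerm
    (Sum.elim (fun h => if h' : ∃ i, r i = h then Sum.inr h'.choose else Sum.inl h)
      (fun i => Sum.inl (r i))) (by
    rintro (h | i)
    · by_cases h' : ∃ i, r i = h
      · simp [h', h'.choose_spec]
      · simp [h']
    · have h' : ∃ j, r j = r i := ⟨i, rfl⟩
      simp [h', hr h'.choose_spec])

section Attach

variable {H I : Type*} (r : I → H) (hr : Function.Injective r) (σ : Perm H)

theorem rootSwap_inr (i : I) : rootSwap r hr (Sum.inr i) = Sum.inl (r i) := rfl

theorem rootSwap_inl_root (i : I) : rootSwap r hr (Sum.inl (r i)) = Sum.inr i := by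
  rw [← rootSwap_inr r hr i]
  exact Function.Involutive.toPerm_involutive _ _

theorem rootSwap_inl_of_ne (h : H) (hh : ∀ i, r i ≠ h) :
    rootSwap r hr (Sum.inl h) = Sum.inl h := by
  exact dif_neg fun ⟨i, hi⟩ => hh i hi

/-- The permutation obtained from `σ` by inserting every `i : I` in front of its root `r i`. -/
noncomputable def attachRoots : Perm (H ⊕ I) :=
  rootSwap r hr * Perm.sumCongr σ 1

theorem attachRoots_inl (h : H) :
    attachRoots r hr σ (Sum.inl h) = rootSwap r hr (Sum.inl (σ h)) := rfl

theorem attachRoots_invariant_iff (Q : H ⊕ I → Prop) :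
    (∀ z, Q (attachRoots r hr σ z) ↔ Q z) ↔
      (∀ h, Q (Sum.inl (σ h)) ↔ Q (Sum.inl h)) ∧ ∀ i, Q (Sum.inl (r i)) ↔ Q (Sum.inr i) := by
  have swap : (∀ i, Q (Sum.inl (r i)) ↔ Q (Sum.inr i)) →
      ∀ h, Q (rootSwap r hr (Sum.inl h)) ↔ Q (Sum.inl h) := by
    intro hQ h
    by_cases hh : ∃ i, r i = h
    · obtain ⟨i, rfl⟩ := hh
      rw [rootSwap_inl_root, hQ]
    · rw [rootSwap_inl_of_ne r hr h fun i hi => hh ⟨i, hi⟩]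
  constructor
  · intro hQ
    have h2 : ∀ i, Q (Sum.inl (r i)) ↔ Q (Sum.inr i) := fun i => hQ (Sum.inr i)
    exact ⟨fun h => by rw [← swap h2, ← attachRoots_inl, hQ], h2⟩
  · rintro ⟨h1, h2⟩ (h | i)
    · rw [attachRoots_inl, swap h2, h1]
    · exact h2 i

theorem sameCycle_attachRoots (i j : I) :
    (attachRoots r hr σ).SameCycle (Sum.inr i) (Sum.inr j) ↔ σ.SameCycle (r i) (r j) := by
  rw [sameCycle_iff_forall_invariant, sameCycle_iff_forall_invariant]
  constructor
  · intro h P hP hi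
    exact h (Sum.elim P (P ∘ r)) ((attachRoots_invariant_iff r hr σ _).2 ⟨hP, fun _ => Iff.rfl⟩) hi
  · intro h P hP hi
    obtain ⟨h1, h2⟩ := (attachRoots_invariant_iff r hr σ _).1 hP
    exact (h2 j).1 (h (fun z => P (Sum.inl z)) h1 ((h2 i).2 hi))

theorem isConn_attachRoots (α : Perm H) :
    IsConn (Perm.sumCongr α (1 : Perm I)) (attachRoots r hr σ) ↔ IsConn α σ := by
  constructor
  · intro h P i1 i2 x y hx
    refine h (Sum.elim P (P ∘ r)) ?_ ((attachRoots_invariant_iff r hr σ _).2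
      ⟨i2, fun _ => Iff.rfl⟩) (Sum.inl x) (Sum.inl y) hx
    rintro (z | z)
    · exact i1 z
    · rfl
  · intro h P i1 i2
    obtain ⟨h1, h2⟩ := (attachRoots_invariant_iff r hr σ _).1 i2
    have key := h (fun z => P (Sum.inl z)) (fun z => i1 (Sum.inl z)) h1
    rintro (x | x) (y | y) hx
    · exact key x y hx
    · exact (h2 y).1 (key _ _ hx)
    · exact key _ _ ((h2 x).2 hx)
    · exact (h2 y).1 (key _ _ ((h2 x).2 hx))

end Attach

theorem isPretransitive_closure_iff_isConn {X : Type*} (α σ : Perm X) :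
    MulAction.IsPretransitive (Subgroup.closure ({α, σ} : Set (Perm X))) X ↔ IsConn α σ := by
  constructor
  · intro h P i1 i2 x y hx
    obtain ⟨⟨g, hg⟩, rfl⟩ := h.exists_smul_eq x y
    have key : ∀ z, P (g z) ↔ P z := by
      induction hg using Subgroup.closure_induction with
      | mem g hg =>
        rcases hg with rfl | rfl
        · exact i1
        · exact i2
      | one => exact fun _ => Iff.rfl
      | mul a b _ _ ha hb => exact fun z => (ha _).trans (hb z)
      | inv a _ ha => exact fun z => by rw [← ha]; simp
    exact (key x).2 hx
  · intro h
    have mα : α ∈ Subgroup.closure ({α, σ} : Set (Perm X)) := Subgroup.subset_closure (by simp)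
    have mσ : σ ∈ Subgroup.closure ({α, σ} : Set (Perm X)) := Subgroup.subset_closure (by simp)
    have step : ∀ (x : X) (τ : Perm X), τ ∈ Subgroup.closure ({α, σ} : Set (Perm X)) → ∀ z,
        (∃ g ∈ Subgroup.closure ({α, σ} : Set (Perm X)), g x = τ z) ↔
          ∃ g ∈ Subgroup.closure ({α, σ} : Set (Perm X)), g x = z := by
      intro x τ hτ z
      constructor
      · rintro ⟨g, hg, e⟩
        exact ⟨τ⁻¹ * g, mul_mem (inv_mem hτ) hg, by simp [e]⟩
      · rintro ⟨g, hg, e⟩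
        exact ⟨τ * g, mul_mem hτ hg, by simp [e]⟩
    refine ⟨fun x y => ?_⟩
    obtain ⟨g, hg, e⟩ := h (fun y => ∃ g ∈ Subgroup.closure ({α, σ} : Set (Perm X)), g x = y)
      (step x α mα) (step x σ mσ) x y ⟨1, one_mem _, rfl⟩
    exact ⟨⟨g, hg⟩, e⟩

theorem exists_eq_sumCongr_one {H I : Type*} [Finite H] [Finite I] (g : Perm (H ⊕ I))
    (hg : ∀ i, g (Sum.inr i) = Sum.inr i) : ∃ σ : Perm H, g = Perm.sumCongr σ 1 := by
  have hm : Set.MapsTo g (Set.range Sum.inl) (Set.range Sum.inl) := by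
    rintro _ ⟨h, rfl⟩
    cases h' : g (Sum.inl h) with
    | inl x => exact ⟨x, rfl⟩
    | inr i =>
      rw [← hg i] at h'
      simpa using g.injective h'
  obtain ⟨⟨σ, ι⟩, rfl⟩ := Perm.mem_sumCongrHom_range_of_perm_mapsTo_inl hm
  refine ⟨σ, ?_⟩
  have : ι = 1 := by
    ext i
    simpa using hg i
  rw [this]
  rfl

theorem isMatchingOff_sumCongr_one {H I : Type*} (α : Perm H) :
    IsMatchingOff (fun x : H ⊕ I => x.isRight = true) (Perm.sumCongr α 1) ↔
      (∀ h, α (α h) = h) ∧ ∀ h, α h ≠ h := by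
  simp [IsMatchingOff, Sum.forall]

namespace NRootedGraph

variable {N e : ℕ}

theorem ext_of_eq {G G' : NRootedGraph N e} (h1 : G.α = G'.α) (h2 : G.σ = G'.σ)
    (h3 : G.root = G'.root) : G = G' := by
  obtain ⟨⟨α, σ, _, _, _⟩, r, _⟩ := G
  obtain ⟨⟨α', σ', _, _, _⟩, r', _⟩ := G'
  obtain rfl : α = α' := h1
  obtain rfl : σ = σ' := h2
  obtain rfl : r = r' := h3
  rfl

theorem root_injective (G : NRootedGraph N e) : Function.Injective G.root := by
  intro i j hij
  by_contra hne
  exact G.distinctVertices i j hne (hij ▸ Perm.SameCycle.refl _ _)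

theorem isConn (G : NRootedGraph N e) : IsConn G.α G.σ :=
  (isPretransitive_closure_iff_isConn _ _).1 G.transitive

/-- The pair of permutations of half-edges and marks that encodes a rooted graph. -/
noncomputable def toPair (G : NRootedGraph N e) :
    Perm (Fin (2 * e) ⊕ Fin N) × Perm (Fin (2 * e) ⊕ Fin N) :=
  (Perm.sumCongr G.α 1, attachRoots G.root G.root_injective G.σ)

theorem toPair_spec (G : NRootedGraph N e) :
    IsMarkedPair (fun x => x.isRight = true) G.toPair ∧ IsConn G.toPair.1 G.toPair.2 := by
  refine ⟨⟨(isMatchingOff_sumCongr_one _).2 ⟨G.involutive, G.fixedPointFree⟩, ?_⟩,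
    (isConn_attachRoots _ _ _ _).2 G.isConn⟩
  rintro (x | i) (y | j) hx hy hxy
  · simp at hx
  · simp at hx
  · simp at hy
  · by_contra hne
    exact G.distinctVertices i j (fun h => hne (congrArg _ h))
      ((sameCycle_attachRoots _ _ _ _ _).1 hxy)

theorem toPair_injective : Function.Injective (toPair : NRootedGraph N e → _) := by
  intro G G' h
  obtain ⟨h1, h2⟩ := Prod.ext_iff.1 h
  have hroot : G.root = G'.root := by
    funext i
    exact Sum.inl_injective (congrArg (fun f => f (Sum.inr i)) h2)
  refine ext_of_eq ?_ ?_ hroot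
  · ext x : 1
    exact Sum.inl_injective (congrArg (fun f => f (Sum.inl x)) h1)
  · ext x : 1
    have h3 := congrArg (fun f => f (Sum.inl x)) h2
    simp only [toPair, attachRoots_inl] at h3
    simp only [hroot] at h3
    exact Sum.inl_injective ((rootSwap _ _).injective h3)

theorem exists_toPair_eq (he : e ≠ 0)
    (p : Perm (Fin (2 * e) ⊕ Fin N) × Perm (Fin (2 * e) ⊕ Fin N))
    (hp : IsMarkedPair (fun x => x.isRight = true) p) (hc : IsConn p.1 p.2) :
    ∃ G : NRootedGraph N e, G.toPair = p := by
  obtain ⟨a, τ⟩ := p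
  obtain ⟨ha, hτ⟩ := hp
  obtain ⟨α, rfl⟩ := exists_eq_sumCongr_one a fun i => (ha.2 _).2 rfl
  have hroot : ∀ i, ∃ h, τ (Sum.inr i) = Sum.inl h := by
    intro i
    cases h' : τ (Sum.inr i) with
    | inl h => exact ⟨h, rfl⟩
    | inr j =>
      exfalso
      have hij : (Sum.inr i : Fin (2 * e) ⊕ Fin N) = Sum.inr j :=
        hτ _ _ rfl rfl (by rw [← h']; exact Perm.sameCycle_apply_right.2 (Perm.SameCycle.refl _ _))
      rw [← hij] at h'
      have := hc (fun z => z = Sum.inr i) (fun z => by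
          constructor
          · intro h
            exact (Perm.sumCongr α (1 : Perm (Fin N))).injective h
          · rintro rfl; rfl)
        (fun z => by
          constructor
          · intro h
            exact τ.injective (h.trans h'.symm)
          · rintro rfl; exact h') (Sum.inr i) (Sum.inl ⟨0, by omega⟩) rfl
      simp at this
  choose r hr using hroot
  have hinj : Function.Injective r := by
    intro i j hij
    have : τ (Sum.inr i) = τ (Sum.inr j) := by rw [hr, hr, hij]
    exact Sum.inr_injective (τ.injective this)
  obtain ⟨σ, hσ⟩ := exists_eq_sumCongr_one ((rootSwap r hinj)⁻¹ * τ) fun i => by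
    rw [Perm.mul_apply, hr, Perm.inv_eq_iff_eq, rootSwap_inr]
  obtain rfl : τ = attachRoots r hinj σ := by
    rw [attachRoots, ← hσ, mul_inv_cancel_left]
  obtain ⟨h1, h2⟩ := (isMatchingOff_sumCongr_one α).1 ha
  refine ⟨⟨⟨α, σ, h1, h2, (isPretransitive_closure_iff_isConn _ _).2
    ((isConn_attachRoots _ _ _ _).1 hc)⟩, r, fun i j hij h => hij ?_⟩, rfl⟩
  exact Sum.inr_injective (hτ _ _ rfl rfl ((sameCycle_attachRoots r hinj σ i j).2 h))

theorem card_eq_connCount (he : e ≠ 0) : Nat.card (NRootedGraph N e) = connCount (2 * e) N := by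
  refine Nat.card_congr (Equiv.ofBijective (fun G => ⟨G.toPair, G.toPair_spec⟩) ⟨?_, ?_⟩)
  · intro G G' h
    exact toPair_injective (congrArg Subtype.val h)
  · rintro ⟨p, hp, hc⟩
    obtain ⟨G, rfl⟩ := exists_toPair_eq he p hp hc
    exact ⟨G, rfl⟩

/-- The graph with half-edges renamed by `ψ`. -/
def relabel (ψ : Perm (Fin (2 * e))) (G : NRootedGraph N e) : NRootedGraph N e where
  α := ψ.permCongr G.α
  σ := ψ.permCongr G.σ
  involutive h := by simp [G.involutive]
  fixedPointFree h := by
    rw [Equiv.permCongr_apply, Ne, ← Equiv.eq_symm_apply]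
    exact G.fixedPointFree _
  transitive := (isPretransitive_closure_iff_isConn _ _).2 ((isConn_permCongr ψ _ _).2 G.isConn)
  root i := ψ (G.root i)
  distinctVertices i j hij h := G.distinctVertices i j hij ((sameCycle_permCongr ψ _ _ _).1 h)

theorem iso_relabel (ψ : Perm (Fin (2 * e))) (G : NRootedGraph N e) : Iso G (relabel ψ G) :=
  ⟨ψ, fun h => by simp [relabel],
    fun h => by simp [relabel], fun _ => rfl⟩

theorem eq_relabel_of_iso {G G' : NRootedGraph N e} (h : Iso G G') :
    ∃ ψ, relabel ψ G = G' := by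
  obtain ⟨ψ, h1, h2, h3⟩ := h
  refine ⟨ψ, ext_of_eq ?_ ?_ (funext h3)⟩
  · ext x : 1
    simp [relabel, ← h1]
  · ext x : 1
    simp [relabel, ← h2]

theorem relabel_left_injective (hN : N ≠ 0) (G : NRootedGraph N e) :
    Function.Injective fun ψ => relabel ψ G := by
  intro ψ ψ' h
  have hα : ∀ x, ψ (G.α (ψ.symm x)) = ψ' (G.α (ψ'.symm x)) := fun x =>
    congrArg (fun G : NRootedGraph N e => G.α x) h
  have hσ : ∀ x, ψ (G.σ (ψ.symm x)) = ψ' (G.σ (ψ'.symm x)) := fun x =>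
    congrArg (fun G : NRootedGraph N e => G.σ x) h
  have hr : ∀ i, ψ (G.root i) = ψ' (G.root i) := fun i =>
    congrArg (fun G : NRootedGraph N e => G.root i) h
  have key : ∀ f : Perm (Fin (2 * e)), (∀ x, ψ (f (ψ.symm x)) = ψ' (f (ψ'.symm x))) →
      ∀ x, ψ (f x) = ψ' (f x) ↔ ψ x = ψ' x := by
    intro f hf x
    have h1 := hf (ψ x)
    rw [Equiv.symm_apply_apply] at h1
    rw [h1]
    constructor
    · intro h2
      have := f.injective (ψ'.injective h2)
      rw [Equiv.symm_apply_eq] at this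
      exact this
    · intro h2
      rw [h2, Equiv.symm_apply_apply]
  ext x : 1
  exact G.isConn (fun x => ψ x = ψ' x) (key _ hα) (key _ hσ) (G.root ⟨0, Nat.pos_of_ne_zero hN⟩) x
    (hr _)

theorem card_eq_card_quotient_mul (hN : N ≠ 0) :
    Nat.card (NRootedGraph N e) =
      Nat.card (Quotient (NRootedGraph.isoSetoid N e)) * (2 * e).factorial := by
  have h : Function.Bijective fun p : Quotient (NRootedGraph.isoSetoid N e) × Perm (Fin (2 * e)) =>
      relabel p.2 p.1.out := by
    constructor
    · rintro ⟨q, ψ⟩ ⟨q', ψ'⟩ h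
      have hq : q = q' := by
        rw [← q.out_eq, ← q'.out_eq]
        have h' := iso_relabel ψ' q'.out
        rw [← show relabel ψ q.out = relabel ψ' q'.out from h] at h'
        exact Quotient.sound (Setoid.trans (iso_relabel ψ q.out) (Setoid.symm h'))
      subst hq
      exact Prod.ext rfl (relabel_left_injective hN _ h)
    · intro G
      obtain ⟨ψ, hψ⟩ := eq_relabel_of_iso (Quotient.mk_out (s := NRootedGraph.isoSetoid N e) G)
      exact ⟨(Quotient.mk _ G, ψ), hψ⟩
  rw [← Nat.card_congr (Equiv.ofBijective _ h), Nat.card_prod, Nat.card_perm, Nat.card_fin]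

end NRootedGraph

theorem connCount_zero (N : ℕ) (hN : N ≠ 0) : connCount 0 N = if N = 1 then 1 else 0 := by
  have hall : ∀ x : Fin 0 ⊕ Fin N, x.isRight = true := by
    rintro (x | x)
    · exact x.elim0
    · rfl
  have hone : ∀ p : Perm (Fin 0 ⊕ Fin N) × Perm (Fin 0 ⊕ Fin N),
      IsMarkedPair (fun x => x.isRight = true) p → p = 1 := by
    rintro ⟨a, τ⟩ ⟨ha, hτ⟩
    refine Prod.ext (Equiv.ext fun x => (ha.2 x).2 (hall x)) (Equiv.ext fun x => ?_)
    exact hτ _ _ (hall _) (hall _) (Perm.sameCycle_apply_left.2 (Perm.SameCycle.refl _ _))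
  split_ifs with h
  · subst h
    refine Nat.card_eq_one_iff_exists.2 ⟨⟨1, ⟨⟨fun _ => rfl, fun x => by simp [hall]⟩, ?_⟩, ?_⟩,
      fun p => Subtype.ext (hone p.1 p.2.1)⟩
    · rintro x y - - hxy
      simpa using hxy
    · rintro P - - (x | x) (y | y) hx
      · exact x.elim0
      · exact x.elim0
      · exact y.elim0
      · rwa [Subsingleton.elim y x]
  · refine Nat.card_eq_zero.2 (Or.inl ⟨fun p => ?_⟩)
    have hp := hone p.1 p.2.1
    have hc := p.2.2
    rw [hp] at hc
    have h01 := hc (fun z => z = Sum.inr ⟨0, by omega⟩) (fun _ => Iff.rfl) (fun _ => Iff.rfl)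
      (Sum.inr ⟨0, by omega⟩) (Sum.inr ⟨1, by omega⟩) rfl
    simp at h01

theorem connCount_eq (n N : ℕ) (hN : N ≠ 0) :
    connCount n N = if Even n then n.factorial * numRooted N (n / 2) else 0 := by
  split_ifs with hn
  · obtain ⟨e, he⟩ := hn
    obtain rfl : n = 2 * e := by omega
    rw [Nat.mul_div_cancel_left _ two_pos, numRooted]
    by_cases h0 : e = 0
    · subst h0
      simpa using connCount_zero N hN
    · rw [if_neg h0, ← NRootedGraph.card_eq_connCount h0,
        NRootedGraph.card_eq_card_quotient_mul hN, mul_comm]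
  · have h0 := markedCount_mul_factorial n N
    rw [if_neg hn, zero_mul, Nat.mul_eq_zero] at h0
    have h1 : markedCount n N = 0 := h0.resolve_right (Nat.factorial_ne_zero N)
    refine Nat.eq_zero_of_le_zero (h1 ▸ ?_)
    exact Nat.card_le_card_of_injective (fun p => ⟨p.1, p.2.1⟩) fun p q h =>
      Subtype.ext (congrArg (fun z => z.1) h)

end Configurations

section ConnectedSum

open PowerSeries

variable {R : Type*} [CommRing R]

theorem mem_weightTuples {N : ℕ} {a : Fin N → ℕ} :
    a ∈ weightTuples N ↔ ∑ j : Fin N, ((j : ℕ) + 1) * a j = N := by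
  simp only [weightTuples, Finset.mem_filter, Fintype.mem_piFinset, Finset.mem_range,
    and_iff_right_iff_imp]
  intro h j
  have h1 : ((j : ℕ) + 1) * a j ≤ ∑ j : Fin N, ((j : ℕ) + 1) * a j :=
    Finset.single_le_sum (f := fun j : Fin N => ((j : ℕ) + 1) * a j) (fun _ _ => Nat.zero_le _)
      (Finset.mem_univ j)
  have h2 : 1 * a j ≤ ((j : ℕ) + 1) * a j := Nat.mul_le_mul_right _ (by omega)
  omega

theorem sum_le_of_mem_weightTuples {N : ℕ} {a : Fin N → ℕ} (ha : a ∈ weightTuples N) :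
    ∑ j, a j ≤ N := by
  conv_rhs => rw [← mem_weightTuples.1 ha]
  exact Finset.sum_le_sum fun j _ => Nat.le_mul_of_pos_left _ (Nat.succ_pos _)

theorem sum_pos_of_mem_weightTuples {N : ℕ} (hN : 1 ≤ N) {a : Fin N → ℕ}
    (ha : a ∈ weightTuples N) : 1 ≤ ∑ j, a j := by
  by_contra h
  have h0 : ∑ j, a j = 0 := by omega
  rw [Finset.sum_eq_zero_iff] at h0
  have := mem_weightTuples.1 ha
  rw [Finset.sum_eq_zero fun j hj => by rw [h0 j hj, mul_zero]] at this
  omega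

theorem coeff_pow_eq_sum_piAntidiag (a : ℕ → R) (N m : ℕ) :
    coeff N ((PowerSeries.mk fun n => if n = 0 then 0 else a n) ^ m) =
      ∑ k ∈ ((Finset.univ : Finset (Fin N)).piAntidiag m).filter
          (fun k => ∑ j : Fin N, ((j : ℕ) + 1) * k j = N),
        (Nat.multinomial Finset.univ k : R) * ∏ j : Fin N, a ((j : ℕ) + 1) ^ k j := by
  set B : R⟦X⟧ := PowerSeries.mk fun n => if n = 0 then 0 else a n with hB
  set b : R⟦X⟧ := ∑ j : Fin N, monomial ((j : ℕ) + 1) (a ((j : ℕ) + 1)) with hb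
  have hdvd : (X : R⟦X⟧) ^ (N + 1) ∣ B - b := by
    rw [X_pow_dvd_iff]
    intro n hn
    rw [map_sub, sub_eq_zero, hB, hb, coeff_mk, map_sum]
    simp only [coeff_monomial]
    split_ifs with h0
    · symm
      exact Finset.sum_eq_zero fun j _ => if_neg (by omega)
    · rw [Finset.sum_eq_single (⟨n - 1, by omega⟩ : Fin N)]
      · have : n - 1 + 1 = n := by omega
        simp [this]
      · intro j _ hj
        refine if_neg fun h => hj (Fin.ext ?_)
        simp only
        omega
      · simp
  have hpow : coeff N (B ^ m) = coeff N (b ^ m) := by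
    have := X_pow_dvd_iff.1 (hdvd.trans (sub_dvd_pow_sub_pow B b m)) N (by omega)
    rwa [map_sub, sub_eq_zero] at this
  rw [hpow, hb, Finset.sum_pow_eq_sum_piAntidiag, map_sum, Finset.sum_filter]
  refine Finset.sum_congr rfl fun k _ => ?_
  simp only [monomial_pow]
  rw [PowerSeries.prod_monomial, ← map_natCast (C (R := R)), coeff_C_mul, coeff_monomial]
  simp only [mul_comm (k _), eq_comm (a := N)]
  split_ifs <;> simp

variable [Algebra ℚ R]

theorem connectedSum_eq_sum_coeff (r : ℕ → R) (N : ℕ) (hN : 1 ≤ N) :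
    connectedSum N r = algebraMap ℚ R (N.factorial : ℚ) * ∑ m ∈ Finset.Icc 1 N,
      algebraMap ℚ R ((-1) ^ (m - 1) / (m : ℚ)) *
        coeff N ((PowerSeries.mk fun n =>
          if n = 0 then 0 else algebraMap ℚ R (1 / (n.factorial : ℚ) ^ 2) * r n) ^ m) := by
  classical
  rw [connectedSum, ← Finset.sum_fiberwise_of_maps_to (t := Finset.Icc 1 N)
    (g := fun a : Fin N → ℕ => ∑ j, a j) fun a ha => Finset.mem_Icc.2
      ⟨sum_pos_of_mem_weightTuples hN ha, sum_le_of_mem_weightTuples ha⟩, Finset.mul_sum]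
  refine Finset.sum_congr rfl fun m hm => ?_
  have hm1 := (Finset.mem_Icc.1 hm).1
  rw [coeff_pow_eq_sum_piAntidiag
    (fun n => algebraMap ℚ R (1 / (n.factorial : ℚ) ^ 2) * r n), Finset.mul_sum, Finset.mul_sum]
  refine Finset.sum_congr ?_ fun a ha => ?_
  · ext a
    simp only [Finset.mem_filter, mem_weightTuples, Finset.mem_piAntidiag]
    simp [and_comm]
  · have hs : ∑ j, a j = m := by
      simpa using (Finset.mem_piAntidiag.1 (Finset.mem_filter.1 ha).1).1
    rw [hs, ← map_natCast (algebraMap ℚ R), ← mul_assoc, ← mul_assoc, ← map_mul, ← mul_assoc, ← map_mul]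
    congr 2
    have hspec := Nat.multinomial_spec (Finset.univ : Finset (Fin N)) a
    rw [hs] at hspec
    have hspec' : (∏ j, ((a j).factorial : ℚ)) * (Nat.multinomial Finset.univ a : ℚ) =
        m.factorial := by exact_mod_cast hspec
    have hne : (∏ j, ((a j).factorial : ℚ)) ≠ 0 :=
      Finset.prod_ne_zero_iff.2 fun j _ => by positivity
    have hm0 : (m : ℚ) ≠ 0 := by positivity
    have hfac : (m.factorial : ℚ) = m * ((m - 1).factorial : ℚ) := by
      exact_mod_cast (Nat.mul_factorial_pred (by omega)).symm
    rw [hfac] at hspec'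
    field_simp
    linear_combination (-(1 : ℚ)) * hspec'

theorem eq_connectedSum_of_recursion (r M : ℕ → R) (h0 : r 0 = 1)
    (hrec : ∀ N : ℕ, ((N : R) + 1) *
        (algebraMap ℚ R (1 / ((N + 1).factorial : ℚ) ^ 2) * r (N + 1)) =
      ∑ i ∈ Finset.range (N + 1), algebraMap ℚ R (1 / (i.factorial : ℚ)) * M (i + 1) *
        (algebraMap ℚ R (1 / ((N - i).factorial : ℚ) ^ 2) * r (N - i)))
    (N : ℕ) (hN : 1 ≤ N) : M N = connectedSum N r := by
  rw [connectedSum_eq_sum_coeff r N hN]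
  set a : ℕ → R := fun n => algebraMap ℚ R (1 / (n.factorial : ℚ) ^ 2) * r n with ha
  set B : R⟦X⟧ := PowerSeries.mk fun n => if n = 0 then 0 else a n with hB
  set S : R⟦X⟧ := PowerSeries.mk fun i => algebraMap ℚ R (1 / (i.factorial : ℚ)) * M (i + 1)
    with hS
  have ha0 : a 0 = 1 := by simp [ha, h0]
  have hA : 1 + B = PowerSeries.mk a := by
    ext n
    rw [map_add, coeff_one, hB, coeff_mk, coeff_mk]
    split_ifs with h
    · rw [h, ha0, add_zero]
    · rw [zero_add]
  have hode : (1 + B) * S = derivative R B := by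
    ext n
    rw [mul_comm, hA, coeff_mul, coeff_derivative, hB, coeff_mk, if_neg (Nat.succ_ne_zero n),
      mul_comm (a (n + 1)), hrec n, Finset.Nat.sum_antidiagonal_eq_sum_range_succ_mk]
    simp [hS, ha]
  set L : R⟦X⟧ := ∑ m ∈ Finset.Icc 1 N, C (algebraMap ℚ R ((-1) ^ (m - 1) / (m : ℚ))) * B ^ m
    with hL
  have hdL : derivative R L = (∑ i ∈ Finset.range N, (-B) ^ i) * derivative R B := by
    rw [hL, map_sum, Finset.sum_mul, Finset.range_eq_Ico,
      ← Finset.sum_Ico_add_right_sub_eq (c := 1)]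
    refine Finset.sum_congr (by ext; simp) fun m hm => ?_
    have hm1 : 1 ≤ m := by simp at hm; omega
    have hm0 : (m : ℚ) ≠ 0 := by positivity
    rw [← smul_eq_C_mul, Derivation.map_smul, Derivation.leibniz_pow, smul_eq_C_mul, neg_pow B,
      nsmul_eq_mul, smul_eq_mul, ← mul_assoc, ← mul_assoc]
    congr 2
    rw [← map_natCast (C (R := R)), ← map_natCast (algebraMap ℚ R), ← map_mul,
      ← map_mul, div_mul_cancel₀ _ hm0]
    simp
  have hkey : (1 + B) * (derivative R L - S) = -((-B) ^ N * derivative R B) := by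
    rw [mul_sub, hode, hdL, ← mul_assoc]
    have := mul_neg_geom_sum (-B) N
    rw [sub_neg_eq_add] at this
    rw [this]
    ring
  have hXB : (X : R⟦X⟧) ∣ B := by
    rw [X_dvd_iff]
    simp [hB, ← coeff_zero_eq_constantCoeff_apply]
  have hunit : IsUnit (1 + B) := by
    rw [isUnit_iff_constantCoeff, map_add, map_one, X_dvd_iff.1 hXB, add_zero]
    exact isUnit_one
  have hdvd : (X : R⟦X⟧) ^ N ∣ derivative R L - S := by
    rw [← hunit.dvd_mul_left, hkey]
    exact ((pow_dvd_pow_of_dvd (hXB.neg_right) N).mul_right _).neg_right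
  have hc := X_pow_dvd_iff.1 hdvd (N - 1) (by omega)
  rw [map_sub, sub_eq_zero, coeff_derivative, hS, coeff_mk, Nat.sub_add_cancel hN] at hc
  have hcL : coeff N L = ∑ m ∈ Finset.Icc 1 N,
      algebraMap ℚ R ((-1) ^ (m - 1) / (m : ℚ)) * coeff N (B ^ m) := by
    simp only [hL, map_sum, coeff_C_mul]
  rw [← hcL]
  have hfac : (N.factorial : ℚ) = ((N - 1).factorial : ℚ) * N := by
    rw [mul_comm]
    exact_mod_cast (Nat.mul_factorial_pred (by omega)).symm
  have hcast : ((N - 1 : ℕ) : R) + 1 = algebraMap ℚ R (N : ℚ) := by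
    rw [map_natCast, ← Nat.cast_add_one, Nat.sub_add_cancel hN]
  rw [hcast] at hc
  rw [hfac, map_mul, mul_assoc, mul_comm (algebraMap ℚ R (N : ℚ)), hc, ← mul_assoc, ← map_mul,
    mul_one_div_cancel (by positivity), map_one, one_mul]

theorem map_connectedSum {S : Type*} [CommRing S] [Algebra ℚ S] (f : R →+* S) (N : ℕ)
    (r : ℕ → R) : f (connectedSum N r) = connectedSum N fun j => f (r j) := by
  have hf : ∀ q : ℚ, f (algebraMap ℚ R q) = algebraMap ℚ S q := fun q =>
    congrArg (fun g : ℚ →+* S => g q) (Subsingleton.elim (f.comp (algebraMap ℚ R)) (algebraMap ℚ S))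
  simp only [connectedSum, map_sum, map_mul, map_prod, map_pow, hf]

theorem sum_lt_of_ne_single {N : ℕ} (hN : 1 ≤ N) {a : Fin N → ℕ} (ha : a ∈ weightTuples N)
    (hne : a ≠ Pi.single ⟨0, hN⟩ N) : ∑ j, a j < N := by
  refine lt_of_le_of_ne (sum_le_of_mem_weightTuples ha) fun hs => hne ?_
  have hw := mem_weightTuples.1 ha
  simp only [add_mul, one_mul, Finset.sum_add_distrib, hs, Nat.add_eq_right] at hw
  rw [Finset.sum_eq_zero_iff] at hw
  have hzero : ∀ j : Fin N, j ≠ ⟨0, hN⟩ → a j = 0 := by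
    intro j hj
    refine (Nat.mul_eq_zero.1 (hw j (Finset.mem_univ j))).resolve_left fun h => hj (Fin.ext h)
  funext j
  by_cases hj : j = ⟨0, hN⟩
  · subst hj
    rw [Pi.single_eq_same]
    rwa [Finset.sum_eq_single ⟨0, hN⟩ (fun j _ hj => hzero j hj) (by simp)] at hs
  · rw [Pi.single_eq_of_ne hj, hzero j hj]

theorem degree_connectedSum [Nontrivial R] (P : ℕ → Polynomial R) (h1 : P 1 = Polynomial.X)
    (hP : ∀ j, (P j).natDegree ≤ 1) (N : ℕ) (hN : 1 ≤ N) : (connectedSum N P).degree = N := by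
  classical
  have hterm : ∀ (c : ℚ) (a : Fin N → ℕ), (algebraMap ℚ (Polynomial R) c * ∏ j : Fin N,
      (algebraMap ℚ (Polynomial R) (1 / (((j : ℕ) + 1).factorial : ℚ) ^ 2) *
        P ((j : ℕ) + 1)) ^ a j).natDegree ≤ ∑ j, a j := by
    intro c a
    rw [Polynomial.algebraMap_apply]
    refine (Polynomial.natDegree_C_mul_le _ _).trans ((Polynomial.natDegree_prod_le _ _).trans
      (Finset.sum_le_sum fun j _ => Polynomial.natDegree_pow_le.trans ?_))
    rw [Polynomial.algebraMap_apply]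
    exact (Nat.mul_le_mul_left _ ((Polynomial.natDegree_C_mul_le _ _).trans (hP _))).trans
      (mul_one _).le
  refine Polynomial.degree_eq_of_le_of_coeff_ne_zero ?_ ?_
  · refine Polynomial.degree_le_of_natDegree_le
      (Polynomial.natDegree_sum_le_of_forall_le _ _ fun a ha => ?_)
    exact (hterm _ a).trans (sum_le_of_mem_weightTuples ha)
  · have hmem : Pi.single ⟨0, hN⟩ N ∈ weightTuples N := by
      rw [mem_weightTuples, Finset.sum_eq_single ⟨0, hN⟩ (fun j _ hj => by
        rw [Pi.single_eq_of_ne hj, mul_zero]) (by simp)]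
      simp
    have hsum : ∑ j : Fin N, (Pi.single ⟨0, hN⟩ N : Fin N → ℕ) j = N := by simp
    have hprod : ∏ j : Fin N, (algebraMap ℚ (Polynomial R)
        (1 / (((j : ℕ) + 1).factorial : ℚ) ^ 2) * P ((j : ℕ) + 1)) ^
          (Pi.single ⟨0, hN⟩ N : Fin N → ℕ) j = Polynomial.X ^ N := by
      rw [Finset.prod_eq_single ⟨0, hN⟩ (fun j _ hj => by
        rw [Pi.single_eq_of_ne hj, pow_zero]) (by simp), Pi.single_eq_same]
      simp [h1]
    rw [connectedSum, Polynomial.finsetSum_coeff, Finset.sum_eq_single _ (fun a ha hne =>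
      Polynomial.coeff_eq_zero_of_natDegree_lt
        ((hterm _ a).trans_lt (sum_lt_of_ne_single hN ha hne))) (fun h => absurd hmem h),
      hsum, hprod, Polynomial.algebraMap_apply, Polynomial.coeff_C_mul,
      Polynomial.coeff_X_pow_self, mul_one]
    refine fun h => ?_
    rw [map_eq_zero_iff _ (algebraMap ℚ R).injective] at h
    have h2 : (∏ j : Fin N, (((Pi.single ⟨0, hN⟩ N : Fin N → ℕ) j).factorial : ℚ)) ≠ 0 :=
      Finset.prod_ne_zero_iff.2 fun j _ => by positivity
    have h3 : ((N - 1).factorial : ℚ) ≠ 0 := by positivity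
    have h4 : (N.factorial : ℚ) ≠ 0 := by positivity
    simp [h3, h4, div_eq_zero_iff, h2] at h

end ConnectedSum

open PowerSeries in
theorem coeff_serZ_eq (n j : ℕ) :
    coeff n (serZ j) = (markedCount n j : ℚ) * j.factorial / n.factorial := by
  have h := markedCount_mul_factorial n j
  have h' : (markedCount n j : ℚ) * j.factorial =
      (if Even n then ((n - 1).doubleFactorial : ℚ) else 0) * (n + j).factorial := by
    exact_mod_cast h
  rw [h', serZ, coeff_mk]
  split_ifs
  · rw [mul_comm]
  · simp

open PowerSeries in
theorem coeff_genM_eq (n N : ℕ) (hN : N ≠ 0) :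
    coeff n (genM N) = (connCount n N : ℚ) / n.factorial := by
  rw [connCount_eq n N hN, genM, coeff_mk]
  split_ifs
  · push_cast
    field_simp
  · simp

open PowerSeries in
theorem serZ_succ (N : ℕ) :
    C (1 / ((N + 1).factorial : ℚ)) * serZ (N + 1) = ∑ i ∈ Finset.range (N + 1),
      C ((N.choose i : ℚ) / ((N - i).factorial : ℚ)) * (genM (i + 1) * serZ (N - i)) := by
  ext n
  rw [map_sum, coeff_C_mul, coeff_serZ_eq, markedCount_succ]
  push_cast
  rw [mul_div_assoc, Finset.sum_mul, Finset.mul_sum]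
  refine Finset.sum_congr rfl fun i _ => ?_
  rw [coeff_C_mul, coeff_mul, Finset.Nat.sum_antidiagonal_eq_sum_range_succ_mk, Finset.mul_sum,
    Finset.mul_sum, Finset.sum_mul, Finset.mul_sum]
  refine Finset.sum_congr rfl fun a ha => ?_
  have ha' : a ≤ n := Nat.lt_succ_iff.1 (Finset.mem_range.1 ha)
  rw [coeff_genM_eq _ _ (Nat.succ_ne_zero i), coeff_serZ_eq, Nat.cast_choose ℚ ha']
  have h1 : ((N + 1).factorial : ℚ) ≠ 0 := by positivity
  field_simp

theorem serZ_one : serZ 1 = genM 1 * serZ 0 := by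
  simpa using serZ_succ 0

open PowerSeries in
/-- The series `∑ₖ (2k + 2s - 1)!! λ^{2k}`. -/
noncomputable def shiftedSeries (s : ℕ) : PowerSeries ℚ :=
  PowerSeries.mk fun i => if Even i then ((i + 2 * s - 1).doubleFactorial : ℚ) else 0

open PowerSeries in
theorem shiftedSeries_zero : shiftedSeries 0 = serZ 0 := by
  ext i
  rw [shiftedSeries, serZ, coeff_mk, coeff_mk]
  split_ifs
  · have : (i.factorial : ℚ) ≠ 0 := by positivity
    rw [Nat.add_zero]
    field_simp
  · rfl

open PowerSeries in
theorem shiftedSeries_one : shiftedSeries 1 = serZ 1 := by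
  ext i
  rw [shiftedSeries, serZ, coeff_mk, coeff_mk]
  split_ifs
  · have : (i.factorial : ℚ) ≠ 0 := by positivity
    rw [show i + 2 * 1 - 1 = i + 1 by omega, Nat.doubleFactorial_add_one, Nat.factorial_succ]
    push_cast
    field_simp
  · rfl

open PowerSeries in
theorem shiftedSeries_eq (s : ℕ) :
    shiftedSeries s = C ((2 * s - 1).doubleFactorial : ℚ) + X ^ 2 * shiftedSeries (s + 1) := by
  ext i
  rw [map_add, coeff_X_pow_mul', coeff_C, shiftedSeries, coeff_mk, shiftedSeries, coeff_mk]
  rcases i with _ | _ | i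
  · simp
  · simp
  · have h : i + 1 + 1 - 2 = i := rfl
    rw [if_neg (show ¬ i + 1 + 1 = 0 by omega), if_pos (show 2 ≤ i + 1 + 1 by omega), h, zero_add]
    congr 1
    · simp [Nat.even_add_one]
    · congr 2
      omega

theorem serZ_zero_eq : serZ 0 = 1 + PowerSeries.X ^ 2 * serZ 1 := by
  have h := shiftedSeries_eq 0
  rw [shiftedSeries_zero, zero_add, shiftedSeries_one] at h
  simpa using h

theorem serZ_zero_mul : serZ 0 * (1 - PowerSeries.X ^ 2 * genM 1) = 1 := by
  have h := serZ_zero_eq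
  rw [serZ_one] at h
  linear_combination h

theorem doubleFactorial_shift (i k : ℕ) :
    (i + 2 * (k + 1) - 1).doubleFactorial = (i + 2 * k + 1) * (i + 2 * k - 1).doubleFactorial := by
  rw [show i + 2 * (k + 1) - 1 = (i + 2 * k) + 1 by omega, Nat.doubleFactorial_add_one]

theorem sum_coeffB_eq (i n : ℕ) :
    ∑ k ∈ Finset.range (n + 1), (-1 : ℚ) ^ (n - k) * (coeffB n k : ℚ) *
        ((i + 2 * k - 1).doubleFactorial : ℚ) =
      (i.descFactorial n : ℚ) * ((i - 1).doubleFactorial : ℚ) := by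
  have hsign : ∀ n, ∑ k ∈ Finset.range (n + 1), (-1 : ℚ) ^ (n - k) * (coeffB n k : ℚ) *
        ((i + 2 * k - 1).doubleFactorial : ℚ) =
      ∑ k ∈ Finset.range (n + 1), (-1 : ℚ) ^ (n + k) * (coeffB n k : ℚ) *
        ((i + 2 * k - 1).doubleFactorial : ℚ) := by
    intro n
    refine Finset.sum_congr rfl fun k hk => ?_
    have hk' : k ≤ n := Nat.lt_succ_iff.1 (Finset.mem_range.1 hk)
    obtain ⟨d, rfl⟩ := Nat.exists_eq_add_of_le hk'
    rw [Nat.add_sub_cancel_left, show k + d + k = d + 2 * k by ring, pow_add, pow_mul]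
    simp
  rw [hsign]
  induction n with
  | zero => simp [coeffB]
  | succ n ih =>
    have hdesc : (i.descFactorial (n + 1) : ℚ) = ((i : ℚ) - n) * i.descFactorial n := by
      rw [Nat.descFactorial_succ]
      rcases le_or_gt n i with h | h
      · push_cast [Nat.cast_sub h]; ring
      · simp [Nat.descFactorial_eq_zero_iff_lt.2 h]
    rw [hdesc, mul_assoc, ← ih, Finset.sum_range_succ']
    set D : ℕ → ℚ := fun k => ((i + 2 * k - 1).doubleFactorial : ℚ) with hD
    have hDs : ∀ k, D (k + 1) = ((i : ℚ) + 2 * k + 1) * D k := by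
      intro k
      simp only [hD]
      rw [doubleFactorial_shift]
      push_cast
      ring
    have hB : coeffB n (n + 1) = 0 := coeffB_eq_zero n (n + 1) (Nat.lt_succ_self n)
    have hshift : ∑ k ∈ Finset.range (n + 1), (-1 : ℚ) ^ (n + (k + 1)) *
          ((2 * ((k + 1 : ℕ) : ℚ) + n + 1) * (coeffB n (k + 1) : ℚ)) * D (k + 1) +
        (-1 : ℚ) ^ (n + 0) * ((2 * ((0 : ℕ) : ℚ) + n + 1) * (coeffB n 0 : ℚ)) * D 0 =
        ∑ k ∈ Finset.range (n + 1), (-1 : ℚ) ^ (n + k) *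
          ((2 * (k : ℚ) + n + 1) * (coeffB n k : ℚ)) * D k := by
      rw [← Finset.sum_range_succ' (fun k => (-1 : ℚ) ^ (n + k) *
          ((2 * (k : ℚ) + n + 1) * (coeffB n k : ℚ)) * D k), Finset.sum_range_succ, hB]
      simp
    have hterm : ∀ k, (-1 : ℚ) ^ (n + 1 + (k + 1)) * (coeffB (n + 1) (k + 1) : ℚ) * D (k + 1) =
        (-1 : ℚ) ^ (n + k) * (coeffB n k : ℚ) * (((i : ℚ) + 2 * k + 1) * D k) -
        (-1 : ℚ) ^ (n + (k + 1)) *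
          ((2 * ((k + 1 : ℕ) : ℚ) + n + 1) * (coeffB n (k + 1) : ℚ)) * D (k + 1) := by
      intro k
      rw [← hDs, coeffB]
      push_cast
      ring
    have hzero : (-1 : ℚ) ^ (n + 1 + 0) * (coeffB (n + 1) 0 : ℚ) * D 0 =
        -((-1 : ℚ) ^ (n + 0) * ((2 * ((0 : ℕ) : ℚ) + n + 1) * (coeffB n 0 : ℚ)) * D 0) := by
      rw [coeffB]
      push_cast
      ring
    rw [Finset.sum_congr rfl fun k _ => hterm k, Finset.sum_sub_distrib, hzero, sub_add,
      sub_neg_eq_add, hshift, ← Finset.sum_sub_distrib, Finset.mul_sum]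
    refine Finset.sum_congr rfl fun k _ => ?_
    ring

theorem sum_choose_descFactorial (i j : ℕ) :
    ∑ n ∈ Finset.range (j + 1), (j.choose n : ℚ) * ((j.factorial : ℚ) / (n.factorial : ℚ)) *
        (i.descFactorial n : ℚ) = ((i + j).factorial : ℚ) / i.factorial := by
  have hv : ((i + j).choose j : ℚ) =
      ∑ n ∈ Finset.range (j + 1), (i.choose n : ℚ) * (j.choose n : ℚ) := by
    rw [Nat.add_choose_eq, Finset.Nat.sum_antidiagonal_eq_sum_range_succ_mk]
    push_cast
    refine Finset.sum_congr rfl fun n hn => ?_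
    rw [Nat.choose_symm (Nat.lt_succ_iff.1 (Finset.mem_range.1 hn))]
  have hc : ((i + j).factorial : ℚ) / i.factorial = j.factorial * ((i + j).choose j : ℚ) := by
    rw [Nat.cast_choose ℚ (Nat.le_add_left j i), Nat.add_sub_cancel]
    field_simp
  rw [hc, hv, Finset.mul_sum]
  refine Finset.sum_congr rfl fun n _ => ?_
  rw [Nat.descFactorial_eq_factorial_mul_choose]
  push_cast
  field_simp

open PowerSeries in
theorem serZ_eq_sum_shiftedSeries (j : ℕ) :
    serZ j = ∑ n ∈ Finset.range (j + 1), ∑ k ∈ Finset.range (n + 1),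
      C ((j.choose n : ℚ) * ((j.factorial : ℚ) / (n.factorial : ℚ)) *
        ((-1) ^ (n - k) * (coeffB n k : ℚ))) * shiftedSeries k := by
  ext i
  simp only [map_sum, coeff_C_mul]
  simp only [serZ, shiftedSeries, coeff_mk]
  split_ifs
  · rw [mul_div_right_comm, ← sum_choose_descFactorial, Finset.sum_mul]
    refine Finset.sum_congr rfl fun n _ => ?_
    rw [mul_assoc, ← sum_coeffB_eq, Finset.mul_sum]
    refine Finset.sum_congr rfl fun k _ => ?_
    ring
  · simp

/-- The polynomial in `X` that represents `∑ₘ (2m + 2k - 1)!! λ^{2m}` divided by `𝒵_0`. -/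
noncomputable def shiftedRatioPoly (k : ℕ) : Polynomial (LaurentPolynomial ℚ) :=
  (if k = 0 then 1 else 0)
    + (if 1 ≤ k then
        Polynomial.C (LaurentPolynomial.T (-(2 * (k : ℤ) - 2))) * Polynomial.X
      else 0)
    - (if 2 ≤ k then
        (1 - Polynomial.C (LaurentPolynomial.T 2) * Polynomial.X) *
          ∑ m ∈ Finset.range (k - 1),
            Polynomial.C (LaurentPolynomial.C ((2 * m + 1).doubleFactorial : ℚ) *
              LaurentPolynomial.T (-(2 * (k : ℤ) - 2 * (m : ℤ) - 2)))
      else 0)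

theorem ratioPoly_eq (j : ℕ) : ratioPoly j =
    ∑ n ∈ Finset.range (j + 1), ∑ k ∈ Finset.range (n + 1),
      Polynomial.C (LaurentPolynomial.C
        ((j.choose n : ℚ) * ((j.factorial : ℚ) / (n.factorial : ℚ)) *
          ((-1) ^ (n - k) * (coeffB n k : ℚ)))) * shiftedRatioPoly k := rfl

theorem natDegree_shiftedRatioPoly_le (k : ℕ) : (shiftedRatioPoly k).natDegree ≤ 1 := by
  have hX : ∀ c : LaurentPolynomial ℚ, (Polynomial.C c * Polynomial.X).natDegree ≤ 1 := fun c =>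
    (Polynomial.natDegree_C_mul_le _ _).trans Polynomial.natDegree_X_le
  refine (Polynomial.natDegree_sub_le _ _).trans (max_le
    ((Polynomial.natDegree_add_le _ _).trans (max_le ?_ ?_)) ?_)
  · split_ifs <;> simp
  · split_ifs
    · exact hX _
    · simp
  · split_ifs
    · rw [← map_sum, mul_comm]
      refine (Polynomial.natDegree_C_mul_le _ _).trans
        ((Polynomial.natDegree_sub_le _ _).trans (max_le (by simp) (hX _)))
    · simp

theorem natDegree_ratioPoly_le (j : ℕ) : (ratioPoly j).natDegree ≤ 1 := by
  rw [ratioPoly_eq]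
  exact Polynomial.natDegree_sum_le_of_forall_le _ _ fun n _ =>
    Polynomial.natDegree_sum_le_of_forall_le _ _ fun k _ =>
      (Polynomial.natDegree_C_mul_le _ _).trans (natDegree_shiftedRatioPoly_le k)

theorem ratioPoly_one : ratioPoly 1 = Polynomial.X := by
  simp [ratioPoly_eq, shiftedRatioPoly, Finset.sum_range_succ, coeffB]

theorem toSeries_T (i : ℤ) :
    toSeries (LaurentPolynomial.T i) = ((PowerSeries.X : PowerSeries ℚ) : ℚ⸨X⸩) ^ i := by
  rw [toSeries, LaurentPolynomial.eval₂_T, Units.val_zpow_eq_zpow_val, PowerSeries.coe_X]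
  rfl

theorem toSeries_C (q : ℚ) :
    toSeries (LaurentPolynomial.C q) = ((PowerSeries.C q : PowerSeries ℚ) : ℚ⸨X⸩) := by
  rw [toSeries, LaurentPolynomial.eval₂_C, PowerSeries.coe_C]

/-- Evaluation at `M_1(λ)` as a ring homomorphism. -/
noncomputable def evalAtM1Hom : Polynomial (LaurentPolynomial ℚ) →+* ℚ⸨X⸩ :=
  Polynomial.eval₂RingHom toSeries (genM 1 : ℚ⸨X⸩)

theorem evalAtM1Hom_apply (P : Polynomial (LaurentPolynomial ℚ)) :
    evalAtM1Hom P = evalAtM1 P := rfl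

theorem evalAtM1Hom_C (c : LaurentPolynomial ℚ) :
    evalAtM1Hom (Polynomial.C c) = toSeries c := Polynomial.eval₂_C _ _

theorem evalAtM1Hom_X : evalAtM1Hom Polynomial.X = (genM 1 : ℚ⸨X⸩) := Polynomial.eval₂_X _ _

theorem coe_X_ne_zero : ((PowerSeries.X : PowerSeries ℚ) : ℚ⸨X⸩) ≠ 0 := by
  rw [PowerSeries.coe_X]
  simp

theorem shiftedSeries_succ_eq (s : ℕ) :
    (shiftedSeries (s + 1) : ℚ⸨X⸩) =
      ((PowerSeries.X : PowerSeries ℚ) : ℚ⸨X⸩) ^ (-(2 * (s : ℤ))) * (shiftedSeries 1 : ℚ⸨X⸩) -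
        ∑ m ∈ Finset.range s, ((PowerSeries.C ((2 * m + 1).doubleFactorial : ℚ) :
          PowerSeries ℚ) : ℚ⸨X⸩) *
            ((PowerSeries.X : PowerSeries ℚ) : ℚ⸨X⸩) ^ (-(2 * (s : ℤ) - 2 * (m : ℤ))) := by
  set l := ((PowerSeries.X : PowerSeries ℚ) : ℚ⸨X⸩) with hl
  have l0 : l ≠ 0 := coe_X_ne_zero
  induction s with
  | zero => simp
  | succ s ih =>
    have h := congrArg (fun f : PowerSeries ℚ => (f : ℚ⸨X⸩)) (shiftedSeries_eq (s + 1))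
    simp only [map_add, map_mul, map_pow, ← hl] at h
    rw [show 2 * (s + 1) - 1 = 2 * s + 1 by omega] at h
    have h' : (shiftedSeries (s + 1 + 1) : ℚ⸨X⸩) = l ^ (-2 : ℤ) *
        ((shiftedSeries (s + 1) : ℚ⸨X⸩) -
          ((PowerSeries.C ((2 * s + 1).doubleFactorial : ℚ) : PowerSeries ℚ) : ℚ⸨X⸩)) := by
      rw [h, add_sub_cancel_left, ← mul_assoc, ← zpow_natCast, ← zpow_add₀ l0]
      simp
    rw [h', ih, Finset.sum_range_succ, mul_sub, mul_sub, ← mul_assoc, ← zpow_add₀ l0,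
      Finset.mul_sum, sub_sub]
    congr 1
    · congr 2
      push_cast
      ring
    · congr 1
      · refine Finset.sum_congr rfl fun m _ => ?_
        rw [mul_left_comm, ← zpow_add₀ l0]
        congr 2
        push_cast
        ring
      · rw [mul_comm]
        congr 2
        push_cast
        ring

theorem evalAtM1Hom_shiftedRatioPoly_mul (k : ℕ) :
    evalAtM1Hom (shiftedRatioPoly k) * (serZ 0 : ℚ⸨X⸩) = (shiftedSeries k : ℚ⸨X⸩) := by
  rcases k with _ | s
  · simp [shiftedRatioPoly, shiftedSeries_zero]
  · have h1 : (genM 1 : ℚ⸨X⸩) * (serZ 0 : ℚ⸨X⸩) = (shiftedSeries 1 : ℚ⸨X⸩) := by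
      rw [shiftedSeries_one, serZ_one, map_mul]
    have h2 : (1 - ((PowerSeries.X : PowerSeries ℚ) : ℚ⸨X⸩) ^ (2 : ℤ) * (genM 1 : ℚ⸨X⸩)) *
        (serZ 0 : ℚ⸨X⸩) = 1 := by
      have h := congrArg (fun f : PowerSeries ℚ => (f : ℚ⸨X⸩)) serZ_zero_mul
      simp only [map_mul, map_sub, map_pow, map_one] at h
      rw [mul_comm, zpow_ofNat]
      exact h
    have hif : ∀ x : Polynomial (LaurentPolynomial ℚ), (if 2 ≤ s + 1 then
        x * ∑ m ∈ Finset.range (s + 1 - 1), Polynomial.C (LaurentPolynomial.C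
          ((2 * m + 1).doubleFactorial : ℚ) *
            LaurentPolynomial.T (-(2 * ((s + 1 : ℕ) : ℤ) - 2 * (m : ℤ) - 2))) else 0) =
        x * ∑ m ∈ Finset.range s, Polynomial.C (LaurentPolynomial.C
          ((2 * m + 1).doubleFactorial : ℚ) *
            LaurentPolynomial.T (-(2 * (s : ℤ) - 2 * (m : ℤ)))) := by
      intro x
      have he : ∀ m : ℕ, -(2 * ((s + 1 : ℕ) : ℤ) - 2 * (m : ℤ) - 2) =
          -(2 * (s : ℤ) - 2 * (m : ℤ)) := fun m => by push_cast; ring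
      simp only [he, Nat.add_sub_cancel]
      rcases s with _ | s
      · simp
      · rw [if_pos (by omega)]
    have he : -(2 * ((s + 1 : ℕ) : ℤ) - 2) = -(2 * (s : ℤ)) := by push_cast; ring
    rw [shiftedRatioPoly, hif, if_neg (Nat.succ_ne_zero s), if_pos (Nat.le_add_left 1 s), zero_add,
      he, shiftedSeries_succ_eq]
    simp only [map_sub, map_mul, map_sum, map_one, evalAtM1Hom_C, evalAtM1Hom_X, toSeries_T,
      toSeries_C]
    rw [sub_mul, mul_assoc, h1, mul_right_comm, h2, one_mul]

theorem evalAtM1Hom_ratioPoly_mul (j : ℕ) :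
    evalAtM1Hom (ratioPoly j) * (serZ 0 : ℚ⸨X⸩) = (serZ j : ℚ⸨X⸩) := by
  rw [ratioPoly_eq, serZ_eq_sum_shiftedSeries j, map_sum, map_sum, Finset.sum_mul]
  refine Finset.sum_congr rfl fun n _ => ?_
  rw [map_sum, map_sum, Finset.sum_mul]
  refine Finset.sum_congr rfl fun k _ => ?_
  rw [map_mul evalAtM1Hom, map_mul (HahnSeries.ofPowerSeries ℤ ℚ), mul_assoc,
    evalAtM1Hom_shiftedRatioPoly_mul, evalAtM1Hom_C, toSeries_C]

theorem coe_serZ_zero_ne_zero : (serZ 0 : ℚ⸨X⸩) ≠ 0 := by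
  intro h
  have h1 := congrArg (fun f : PowerSeries ℚ => (f : ℚ⸨X⸩)) serZ_zero_mul
  simp [h] at h1

theorem serZ_div_eq (j : ℕ) :
    (serZ j : ℚ⸨X⸩) / (serZ 0 : ℚ⸨X⸩) = evalAtM1 (ratioPoly j) := by
  rw [div_eq_iff coe_serZ_zero_ne_zero, ← evalAtM1Hom_apply, evalAtM1Hom_ratioPoly_mul]

theorem coe_C_eq_algebraMap (q : ℚ) :
    ((PowerSeries.C q : PowerSeries ℚ) : ℚ⸨X⸩) = algebraMap ℚ ℚ⸨X⸩ q :=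
  congrArg (fun g : ℚ →+* ℚ⸨X⸩ => g q) (Subsingleton.elim
    ((HahnSeries.ofPowerSeries ℤ ℚ).comp (PowerSeries.C : ℚ →+* PowerSeries ℚ)) (algebraMap ℚ ℚ⸨X⸩))

theorem genM_eq_connectedSum (N : ℕ) (hN : 1 ≤ N) :
    (genM N : ℚ⸨X⸩) =
      connectedSum N (fun j => (serZ j : ℚ⸨X⸩) / (serZ 0 : ℚ⸨X⸩)) := by
  have z0 := coe_serZ_zero_ne_zero
  refine eq_connectedSum_of_recursion _ (fun N => (genM N : ℚ⸨X⸩)) (div_self z0) (fun N => ?_) N hN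
  have h := congrArg (fun f : PowerSeries ℚ => (f : ℚ⸨X⸩)) (serZ_succ N)
  simp only [map_mul, map_sum, coe_C_eq_algebraMap] at h
  have hq : algebraMap ℚ ℚ⸨X⸩ (1 / (N.factorial : ℚ)) *
      algebraMap ℚ ℚ⸨X⸩ (1 / ((N + 1).factorial : ℚ)) =
        ((N : ℚ⸨X⸩) + 1) * algebraMap ℚ ℚ⸨X⸩ (1 / ((N + 1).factorial : ℚ) ^ 2) := by
    rw [← map_mul, ← Nat.cast_add_one, ← map_natCast (algebraMap ℚ ℚ⸨X⸩), ← map_mul]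
    congr 1
    rw [Nat.factorial_succ]
    push_cast
    field_simp
  rw [← mul_assoc, ← hq, mul_div_assoc', mul_assoc, h, Finset.mul_sum, Finset.sum_div]
  refine Finset.sum_congr rfl fun i hi => ?_
  have hi' : i ≤ N := Nat.lt_succ_iff.1 (Finset.mem_range.1 hi)
  have hq2 : algebraMap ℚ ℚ⸨X⸩ (1 / (N.factorial : ℚ)) *
      algebraMap ℚ ℚ⸨X⸩ ((N.choose i : ℚ) / ((N - i).factorial : ℚ)) =
        algebraMap ℚ ℚ⸨X⸩ (1 / (i.factorial : ℚ)) *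
          algebraMap ℚ ℚ⸨X⸩ (1 / ((N - i).factorial : ℚ) ^ 2) := by
    rw [← map_mul, ← map_mul, Nat.cast_choose ℚ hi']
    congr 1
    field_simp
  rw [← mul_assoc, hq2]
  ring

theorem theorem3 :
    ((serZ 0 - 1 = PowerSeries.X ^ 2 * genM 1 * serZ 0) ∧
      ((serZ 0)⁻¹ = 1 - PowerSeries.X ^ 2 * genM 1)) ∧
    (∀ j : ℕ, (serZ j : ℚ⸨X⸩) / (serZ 0 : ℚ⸨X⸩) = evalAtM1 (ratioPoly j)) ∧
    (∀ N : ℕ, 1 ≤ N →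
      (genM N : ℚ⸨X⸩) = connectedSum N (fun j => (serZ j : ℚ⸨X⸩) / (serZ 0 : ℚ⸨X⸩)) ∧
      (genM N : ℚ⸨X⸩) = evalAtM1 (connectedSum N ratioPoly) ∧
      (connectedSum N ratioPoly).degree = N) := by
  refine ⟨⟨?_, ?_⟩, serZ_div_eq, fun N hN => ⟨genM_eq_connectedSum N hN, ?_, ?_⟩⟩
  · linear_combination serZ_zero_mul
  · rw [PowerSeries.inv_eq_iff_mul_eq_one, mul_comm]
    · exact serZ_zero_mul
    · intro h
      have := congrArg PowerSeries.constantCoeff serZ_zero_mul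
      simp [h] at this
  · rw [genM_eq_connectedSum N hN, ← evalAtM1Hom_apply, map_connectedSum]
    simp only [evalAtM1Hom_apply, serZ_div_eq]
  · exact degree_connectedSum ratioPoly ratioPoly_one natDegree_ratioPoly_le N hN
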